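/- Let $n$ be a positive integer and $1\le q<n$. Write points of $\mathbb R^{n+1}$ as $\hat x=(x,z)$ with $x\in\mathbb R^n$, $z\in\mathbb R$. For $t>0$ and $j\in\mathbb Z$ let $\rho_j(y,w)=(y,\,2tj+(-1)^jw)$, and on the strip $S(t)=\mathbb R^n\times(-t,t)$ define the kernel \[ G_t(\hat x,\hat y)=\sum_{j\in\mathbb Z}\frac1{|\hat x-\rho_j(\hat y)|^q}\quad(q>1), \] \[ G_t(\hat x,\hat y)=\frac1{|\hat x-\hat y|}+\sum_{j\ne0}\Big(\frac1{|\hat x-\rho_j(\hat y)|}-\frac1{|2tj|}\Big)+\frac1t\big(\gamma-\log(4t)\big)\quad(q=1), \] with $G_t=+\infty$ on the diagonal, where $\gamma$ is the Euler--Mascheroni constant. For a compact set $K\subset\mathbb R^n$, identified with $K\times\{0\}\subset S(t)$, put \[ V_q(K)=\min_\mu\int_K\!\int_K\frac{d\mu(x)\,d\mu(y)}{|x-y|^q},\qquad E_K(t)=\min_\mu\int_K\!\int_K G_t(\hat x,\hat y)\,d\mu(\hat x)\,d\mu(\hat y), \] the minima being over all Borel probability measures on $K$ (infima, hence $+\infty$,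 if $K=\emptyset$). A measure attaining the minimum $V_q(K)$ is called a $q$-equilibrium measure of $K$. Suppose that $V_q(K)<\infty$. Then $K$ has exactly one $q$-equilibrium measure $\mu_\infty$, for every $t>0$ the minimum $E_K(t)$ is attained and finite, and \[ E_K(t)=V_q(K)+\frac{A_q(t)}{(2t)^q}-\frac{2B_q}{(2t)^{q+2}}\int_K|x-x_{K,\infty}|^2\,d\mu_\infty(x)+o\big(t^{-(q+2)}\big)\qquad\text{as }t\to\infty, \] where $x_{K,\infty}=\int_K x\,d\mu_\infty(x)$ is the centroid of $\mu_\infty$, $B_q=q\,\zeta(q+2)$, and $A_q(t)=2\zeta(q)$ if $q>1$, while $A_q(t)=2(\gamma-\log(4t))$ if $q=1$; here $\zeta$ is the Riemann zeta function. -/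

import Mathlib

open MeasureTheory Filter Asymptotics

namespace StripEnergy

section General

variable {X : Type*} [MeasurableSpace X]

/-- `∫∫ G(x,y) dμ(x) dμ(y)` for a kernel with values in `[-∞,∞]`, as the integral of the positive
part minus the integral of the negative part. Kernels below are bounded below on the sets where
they are used, so that the second integral is finite and the difference is meaningful. -/
noncomputable def kernelEnergy (G : X → X → EReal) (μ : Measure X) : EReal :=
  ((∫⁻ x, ∫⁻ y, (G x y).toENNReal ∂μ ∂μ : ENNReal) : EReal)
    - ((∫⁻ x, ∫⁻ y, (-G x y).toENNReal ∂μ ∂μ : ENNReal) : EReal)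

/-- `μ` is a probability measure on the set `K`. -/
def IsProbOn (K : Set X) (μ : Measure X) : Prop :=
  IsProbabilityMeasure μ ∧ μ Kᶜ = 0

/-- The least energy over all probability measures on `K`; it equals `+∞` for `K = ∅`. -/
noncomputable def minEnergy (G : X → X → EReal) (K : Set X) : EReal :=
  ⨅ (μ : Measure X) (_ : IsProbOn K μ), kernelEnergy G μ

/-- `μ` is a probability measure on `K` that attains the least energy. -/
def IsEquilibriumMeasure (G : X → X → EReal) (K : Set X) (μ : Measure X) : Prop :=
  IsProbOn K μ ∧ kernelEnergy G μ = minEnergy G K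

end General

/-- The Riesz kernel `|x - y|^{-q}`, equal to `+∞` on the diagonal (for `q > 0`). -/
noncomputable def rieszKernel {X : Type*} [PseudoEMetricSpace X] (q : ℝ) (x y : X) : EReal :=
  ((edist x y ^ (-q) : ENNReal) : EReal)

/-- The Riesz `q`-energy `V_q(K)`. -/
noncomputable def rieszEnergy {X : Type*} [PseudoEMetricSpace X] [MeasurableSpace X]
    (q : ℝ) (K : Set X) : EReal :=
  minEnergy (rieszKernel q) K

/-- `ℝⁿ⁺¹ = ℝⁿ × ℝ` with its Euclidean norm; points are written `(x, z)`. -/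
abbrev Space (n : ℕ) : Type := WithLp 2 (EuclideanSpace ℝ (Fin n) × ℝ)

/-- The point `(x, z)` of `ℝⁿ⁺¹`. -/
def point {n : ℕ} (x : EuclideanSpace ℝ (Fin n)) (z : ℝ) : Space n := WithLp.toLp 2 (x, z)

/-- `ρ_j(y, w) = (y, 2tj + (-1)^j w)`: the `j`-th iterated reflection in the boundary planes
of the strip `ℝⁿ × (-t, t)`. -/
noncomputable def rho {n : ℕ} (t : ℝ) (j : ℤ) (y : Space n) : Space n :=
  point y.fst (2 * t * (j : ℝ) + (-1 : ℝ) ^ j * y.snd)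

open Classical in
/-- The Neumann strip kernel `G_t` with exponent `q ≥ 1` on the closed strip `ℝⁿ × [-t, t]`,
`t > 0`. It is `+∞` at the poles of the series (in the open strip: on the diagonal). Elsewhere it
is the sum over reflections of `|x - ρ_j(y)|^{-q}` if `q > 1`, and the renormalized sum if
`q = 1`. Both series converge absolutely. -/
noncomputable def stripKernel {n : ℕ} (q t : ℝ) (x y : Space n) : EReal :=
  if ∃ j : ℤ, x = rho t j y then ⊤
  else if q = 1 then
    ((1 / dist x y
      + ∑' j : {j : ℤ // j ≠ 0}, (1 / dist x (rho t j y) - 1 / |2 * t * ((j : ℤ) : ℝ)|)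
      + 1 / t * (Real.eulerMascheroniConstant - Real.log (4 * t)) : ℝ) : EReal)
  else
    ((∑' j : ℤ, 1 / dist x (rho t j y) ^ q : ℝ) : EReal)

/-- The strip energy `E_K(t)` of a set `K ⊆ ℝⁿ × (-t, t)`. -/
noncomputable def stripEnergy {n : ℕ} (q : ℝ) (K : Set (Space n)) (t : ℝ) : EReal :=
  minEnergy (stripKernel q t) K

/-- A set in `ℝⁿ`, regarded as the subset `K × {0}` of `ℝⁿ⁺¹`. -/
def embed {n : ℕ} (K : Set (EuclideanSpace ℝ (Fin n))) : Set (Space n) :=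
  (fun x => point x 0) '' K

/-- The coefficient `A_q(t)`. -/
noncomputable def coeffA (q t : ℝ) : ℝ :=
  if q = 1 then 2 * (Real.eulerMascheroniConstant - Real.log (4 * t))
  else 2 * (riemannZeta (q : ℂ)).re

/-- The coefficient `B_q = q ζ(q+2)`. -/
noncomputable def coeffB (q : ℝ) : ℝ := q * (riemannZeta ((q + 2 : ℝ) : ℂ)).re

/-- The centroid of a measure on `ℝⁿ`. -/
noncomputable def centroid {n : ℕ} (μ : Measure (EuclideanSpace ℝ (Fin n))) :
    EuclideanSpace ℝ (Fin n) :=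
  ∫ x, x ∂μ

/-- The second moment of a measure about its centroid. -/
noncomputable def secondMoment {n : ℕ} (μ : Measure (EuclideanSpace ℝ (Fin n))) : ℝ :=
  ∫ x, ‖x - centroid μ‖ ^ 2 ∂μ

end StripEnergy

/-! On `K × {0}` the reflections of `(y, 0)` are the points `(y, 2tj)`, so `G_t` depends on `u = |x
- y|²` only. Splitting off `j = 0` and pairing `j` with `-j` gives the Riesz kernel, plus the
constant `A_q(t)/(2t)^q`, plus `reflectionPart`, which is `-b u + O(t^{-(q+4)})` with `b = B_q
(2t)^{-(q+2)}`, uniformly for bounded `u` (`stripKernel_point`, `reflectionPart_bounds`). Up to the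
constant, `E_K(t)` is thus the minimum of `I(μ) - b D(μ) + O(t^{-(q+4)})`, where `I` is the Riesz
energy and `D(μ) = ∬ |x - y|²` is twice the second moment about the centroid.

Testing with `μ_∞` gives the upper bound. For the lower bound, a minimizer `μ_t` satisfies `I(μ_t) ≥
V_q(K)`, so it suffices that `D(μ_t) ≤ D(μ_∞) + ε` for large `t`. Minimality forces `I(μ_t) →
V_q(K)`; since `I` is lower semicontinuous and `D` continuous on the compact space of probability
measures, uniqueness of `μ_∞` yields this bound (`exists_pos_forall_le_add`).

Uniqueness holds because the Riesz kernel is a superposition of Gaussians: the energy is the squared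
`L²` norm of a potential, strict convexity makes the potentials of two minimizers agree, and
Gaussian potentials determine the measure through its characteristic function. -/

namespace StripEnergy

open scoped ENNReal NNReal Topology

/-! ### Weak compactness, semicontinuity of the energy, and stability of a unique minimizer. -/

section Compactness

variable {C : Type*} [MetricSpace C] [CompactSpace C] [MeasurableSpace C] [BorelSpace C]

/-- Integration of a truncated continuous kernel is weakly continuous. -/
lemma continuous_lintegral_min (κ : C → ℝ≥0∞) (hκ : Continuous κ) (m : ℝ≥0) :
    Continuous fun μ : ProbabilityMeasure C => ∫⁻ z, min (κ z) m ∂(μ : Measure C) := by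
  have hc : Continuous fun z => (min (κ z) (m : ℝ≥0∞)).toNNReal :=
    ENNReal.continuousOn_toNNReal.comp_continuous (hκ.min continuous_const)
      fun z => ((min_le_right _ _).trans_lt ENNReal.coe_lt_top).ne
  let f : BoundedContinuousFunction C ℝ≥0 := BoundedContinuousFunction.mkOfCompact ⟨_, hc⟩
  have h : ∀ z, min (κ z) (m : ℝ≥0∞) = (f z : ℝ≥0∞) := fun z =>
    (ENNReal.coe_toNNReal ((min_le_right _ _).trans_lt ENNReal.coe_lt_top).ne).symm
  simp_rw [h]
  rw [continuous_iff_continuousAt]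
  intro μ
  exact ProbabilityMeasure.tendsto_iff_forall_lintegral_tendsto.1 tendsto_id f

/-- Integration of a continuous nonnegative kernel is weakly lower semicontinuous. -/
lemma lowerSemicontinuous_lintegral (κ : C → ℝ≥0∞) (hκ : Continuous κ) :
    LowerSemicontinuous fun μ : ProbabilityMeasure C => ∫⁻ z, κ z ∂(μ : Measure C) := by
  -- Monotone convergence along truncations writes the integral as a supremum of continuous
  -- functionals.
  have h : ∀ μ : ProbabilityMeasure C, ∫⁻ z, κ z ∂(μ : Measure C)
      = ⨆ m : ℕ, ∫⁻ z, min (κ z) ((m : ℝ≥0) : ℝ≥0∞) ∂(μ : Measure C) := by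
    intro μ
    rw [← lintegral_iSup (fun m => (hκ.min continuous_const).measurable)
      (fun a b hab z => min_le_min le_rfl
        (ENNReal.coe_le_coe.2 (Nat.cast_le.2 hab)))]
    refine lintegral_congr fun z => le_antisymm ?_ (iSup_le fun m => min_le_left _ _)
    rcases eq_or_ne (κ z) ⊤ with hz | hz
    · simp [hz, ENNReal.iSup_natCast]
    · obtain ⟨m, hm⟩ := ENNReal.exists_nat_gt hz
      exact (le_min le_rfl (by simpa using hm.le)).trans
        (le_iSup (fun m : ℕ => min (κ z) ((m : ℝ≥0) : ℝ≥0∞)) m)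
  simp_rw [h]
  exact lowerSemicontinuous_iSup fun m => (continuous_lintegral_min κ hκ m).lowerSemicontinuous

/-- The energy of `μ` with respect to the nonnegative kernel `κ`. -/
noncomputable def energy (κ : C × C → ℝ≥0∞) (μ : ProbabilityMeasure C) : ℝ≥0∞ :=
  ∫⁻ z, κ z ∂((μ : Measure C).prod (μ : Measure C))

/-- The energy of `μ` with respect to the real kernel `h`. -/
noncomputable def realEnergy (h : C × C → ℝ) (μ : ProbabilityMeasure C) : ℝ :=
  ∫ z, h z ∂((μ : Measure C).prod (μ : Measure C))

lemma continuous_diagonal_prod :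
    Continuous fun μ : ProbabilityMeasure C => μ.prod μ :=
  ProbabilityMeasure.continuous_prod.comp (continuous_id.prodMk continuous_id)

lemma lowerSemicontinuous_energy {κ : C × C → ℝ≥0∞} (hκ : Continuous κ) :
    LowerSemicontinuous (energy κ) :=
  (lowerSemicontinuous_lintegral κ hκ).comp continuous_diagonal_prod

lemma continuous_realEnergy {h : C × C → ℝ} (hh : Continuous h) :
    Continuous (realEnergy h) := by
  have := ProbabilityMeasure.continuous_integral_boundedContinuousFunction
    (BoundedContinuousFunction.mkOfCompact ⟨h, hh⟩)
  exact this.comp continuous_diagonal_prod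

/-- A continuous nonnegative kernel has an energy minimizer. -/
lemma exists_forall_energy_le [Nonempty C] {κ : C × C → ℝ≥0∞} (hκ : Continuous κ) :
    ∃ μ, ∀ ν, energy κ μ ≤ energy κ ν := by
  have : Nonempty (ProbabilityMeasure C) := ⟨diracProba (Classical.arbitrary C)⟩
  obtain ⟨μ, -, hμ⟩ := LowerSemicontinuousOn.exists_isMinOn
    (s := (Set.univ : Set (ProbabilityMeasure C))) Set.univ_nonempty isCompact_univ
    ((lowerSemicontinuous_energy hκ).lowerSemicontinuousOn _)
  exact ⟨μ, fun ν => hμ (Set.mem_univ ν)⟩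

/-- If the energy has a unique minimizer `μ₀`, then a continuous functional cannot be much larger
at near-minimizers than at `μ₀`. -/
lemma exists_pos_forall_le_add {κ : C × C → ℝ≥0∞} (hκ : Continuous κ)
    {D : ProbabilityMeasure C → ℝ} (hD : Continuous D) {μ₀ : ProbabilityMeasure C}
    (huniq : ∀ ν, energy κ ν ≤ energy κ μ₀ → ν = μ₀)
    {ε : ℝ} (hε : 0 < ε) :
    ∃ δ : ℝ, 0 < δ ∧
      ∀ μ, energy κ μ ≤ energy κ μ₀ + ENNReal.ofReal δ → D μ ≤ D μ₀ + ε := by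
  -- The energy attains its minimum on this compact set, and by uniqueness that minimum exceeds the
  -- energy of `μ₀`; any `δ` smaller than the gap works.
  let S : Set (ProbabilityMeasure C) := {μ | D μ₀ + ε ≤ D μ}
  have hS : IsCompact S := (isClosed_le continuous_const hD).isCompact
  rcases S.eq_empty_or_nonempty with hemp | hne
  · refine ⟨1, one_pos, fun μ _ => ?_⟩
    by_contra hlt
    exact (hemp ▸ (show μ ∈ S from (not_le.1 hlt).le) : μ ∈ (∅ : Set _))
  · obtain ⟨ν, hνS, hν⟩ := LowerSemicontinuousOn.exists_isMinOn hne hS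
      ((lowerSemicontinuous_energy hκ).lowerSemicontinuousOn _)
    have hlt : energy κ μ₀ < energy κ ν := by
      by_contra hle
      have := huniq ν (not_lt.1 hle)
      rw [this] at hνS
      have : D μ₀ + ε ≤ D μ₀ := hνS
      linarith
    -- The energy of `ν` may be infinite; an intermediate value keeps `δ` finite and the final
    -- inequality strict.
    obtain ⟨c, hc1, hc2⟩ := exists_between hlt
    have hctop : c ≠ ⊤ := (hc2.trans_le le_top).ne
    refine ⟨(c - energy κ μ₀).toReal, ENNReal.toReal_pos (tsub_pos_of_lt hc1).ne'
      (ENNReal.sub_ne_top hctop), fun μ hμ => ?_⟩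
    rw [ENNReal.ofReal_toReal (ENNReal.sub_ne_top hctop), add_tsub_cancel_of_le hc1.le] at hμ
    by_contra hgt
    have hμS : μ ∈ S := (not_le.1 hgt).le
    exact absurd (hν hμS) (not_le.2 (hμ.trans_lt hc2))

end Compactness

/-! ### Strict convexity of energies given by a feature map. -/

section PositiveDefinite

lemma sq_half_add_le (a b : ℝ≥0∞) : ((a + b) / 2) ^ 2 ≤ (a ^ 2 + b ^ 2) / 2 := by
  rcases eq_or_ne a ⊤ with rfl | ha
  · simp [ENNReal.top_div]
  rcases eq_or_ne b ⊤ with rfl | hb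
  · simp [ENNReal.top_div]
  lift a to ℝ≥0 using ha
  lift b to ℝ≥0 using hb
  rw [← ENNReal.coe_two]
  norm_cast
  rw [← NNReal.coe_le_coe]
  push_cast
  nlinarith [sq_nonneg ((a : ℝ) - b)]

lemma eq_of_sq_half_add_eq {a b : ℝ≥0∞} (hfin : (a ^ 2 + b ^ 2) / 2 ≠ ⊤)
    (h : ((a + b) / 2) ^ 2 = (a ^ 2 + b ^ 2) / 2) : a = b := by
  rcases eq_or_ne a ⊤ with rfl | ha
  · simp [ENNReal.top_div] at hfin
  rcases eq_or_ne b ⊤ with rfl | hb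
  · simp [ENNReal.top_div] at hfin
  lift a to ℝ≥0 using ha
  lift b to ℝ≥0 using hb
  rw [← ENNReal.coe_two] at h
  norm_cast at h ⊢
  rw [← NNReal.coe_inj] at h ⊢
  push_cast at h
  nlinarith [sq_nonneg ((a : ℝ) - b)]

/-- Strict midpoint convexity of the squared norm in `L²`. -/
lemma ae_eq_of_lintegral_sq_le {Z : Type*} [MeasurableSpace Z] {lam : Measure Z}
    {a b : Z → ℝ≥0∞} (ha : Measurable a) (hb : Measurable b) {V : ℝ≥0∞} (hV : V ≠ ⊤)
    (haV : ∫⁻ z, a z ^ 2 ∂lam ≤ V) (hbV : ∫⁻ z, b z ^ 2 ∂lam ≤ V)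
    (hab : V ≤ ∫⁻ z, ((a z + b z) / 2) ^ 2 ∂lam) : a =ᵐ[lam] b := by
  have hm : Measurable fun z => (a z ^ 2 + b z ^ 2) / 2 :=
    ((ha.pow_const 2).add (hb.pow_const 2)).div_const 2
  have hint : ∫⁻ z, (a z ^ 2 + b z ^ 2) / 2 ∂lam ≤ V := by
    simp_rw [ENNReal.div_eq_inv_mul]
    rw [lintegral_const_mul _ (by fun_prop),
      lintegral_add_left (ha.pow_const 2)]
    calc _ ≤ 2⁻¹ * (V + V) := by gcongr
      _ = V := by rw [← two_mul, ← mul_assoc, ENNReal.inv_mul_cancel (by simp) (by simp), one_mul]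
  have hle : ∀ z, ((a z + b z) / 2) ^ 2 ≤ (a z ^ 2 + b z ^ 2) / 2 :=
    fun z => sq_half_add_le _ _
  -- The integral of the larger side is at most `V`, that of the smaller at least `V`, so the
  -- pointwise inequality is an equality almost everywhere.
  have heq := ae_eq_of_ae_le_of_lintegral_le (Eventually.of_forall hle)
    ((lintegral_mono hle).trans_lt (hint.trans_lt hV.lt_top)).ne hm.aemeasurable (hint.trans hab)
  filter_upwards [heq, ae_lt_top hm (hint.trans_lt hV.lt_top).ne] with z hz hz'
  exact eq_of_sq_half_add_eq hz'.ne hz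

/-- The energy of a kernel `∫ Φ(x,·) Φ(y,·)` is the squared norm of the potential. -/
lemma lintegral_lintegral_feature {X Z : Type*} [MeasurableSpace X] [MeasurableSpace Z]
    {lam : Measure Z} [SFinite lam] {Φ : X → Z → ℝ≥0∞} (hΦ : Measurable (Function.uncurry Φ))
    (μ : Measure X) [SFinite μ] :
    ∫⁻ x, ∫⁻ y, ∫⁻ z, Φ x z * Φ y z ∂lam ∂μ ∂μ = ∫⁻ z, (∫⁻ x, Φ x z ∂μ) ^ 2 ∂lam := by
  have hx : ∀ x, Measurable (Φ x) := fun x => hΦ.comp measurable_prodMk_left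
  have hz : ∀ z, Measurable (fun x => Φ x z) := fun z => hΦ.comp measurable_prodMk_right
  have hU : Measurable fun z => ∫⁻ x, Φ x z ∂μ := hΦ.lintegral_prod_left'
  have h1 : ∀ x, ∫⁻ y, ∫⁻ z, Φ x z * Φ y z ∂lam ∂μ = ∫⁻ z, Φ x z * ∫⁻ y, Φ y z ∂μ ∂lam := by
    intro x
    rw [lintegral_lintegral_swap]
    · exact lintegral_congr fun z => lintegral_const_mul _ (hz z)
    · exact (((hx x).comp measurable_snd).mul hΦ).aemeasurable
  simp_rw [h1]
  rw [lintegral_lintegral_swap]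
  · refine lintegral_congr fun z => ?_
    rw [lintegral_mul_const _ (hz z), sq]
  · exact (hΦ.mul (hU.comp measurable_snd)).aemeasurable

/-- For a kernel with a feature map, two energy minimizers whose midpoint does not have smaller
energy have the same potential. -/
lemma feature_ae_eq {X Z : Type*} [MeasurableSpace X] [MeasurableSpace Z]
    {lam : Measure Z} [SFinite lam] {Φ : X → Z → ℝ≥0∞} (hΦ : Measurable (Function.uncurry Φ))
    {k : X → X → ℝ≥0∞} (hk : ∀ x y, k x y = ∫⁻ z, Φ x z * Φ y z ∂lam)
    {μ ν : Measure X} [IsFiniteMeasure μ] [IsFiniteMeasure ν] {V : ℝ≥0∞} (hV : V ≠ ⊤)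
    (hμ : ∫⁻ x, ∫⁻ y, k x y ∂μ ∂μ ≤ V) (hν : ∫⁻ x, ∫⁻ y, k x y ∂ν ∂ν ≤ V)
    (hμν : V ≤ ∫⁻ x, ∫⁻ y, k x y ∂((2⁻¹ : ℝ≥0∞) • (μ + ν)) ∂((2⁻¹ : ℝ≥0∞) • (μ + ν))) :
    (fun z => ∫⁻ x, Φ x z ∂μ) =ᵐ[lam] (fun z => ∫⁻ x, Φ x z ∂ν) := by
  have hfin : IsFiniteMeasure ((2⁻¹ : ℝ≥0∞) • (μ + ν)) := Measure.smul_finite _ (by simp)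
  simp_rw [hk] at hμ hν hμν
  rw [lintegral_lintegral_feature hΦ] at hμ hν hμν
  refine ae_eq_of_lintegral_sq_le hΦ.lintegral_prod_left' hΦ.lintegral_prod_left' hV hμ hν ?_
  simpa only [lintegral_smul_measure, lintegral_add_measure, smul_eq_mul,
    ENNReal.div_eq_inv_mul] using hμν

end PositiveDefinite

/-! ### The Riesz kernel as a mixture of Gaussians, and uniqueness from Fourier analysis. -/

section Gaussian

variable {E : Type*} [NormedAddCommGroup E] [InnerProductSpace ℝ E] [FiniteDimensional ℝ E]
  [MeasurableSpace E] [BorelSpace E]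

/-- The heat-type bump `exp (-2s|x-z|²)` as an extended nonnegative real. -/
noncomputable def bump (x : E) (p : ℝ × E) : ℝ≥0∞ :=
  ENNReal.ofReal (Real.exp (-(2 * p.1) * ‖x - p.2‖ ^ 2))

lemma measurable_bump : Measurable (Function.uncurry (bump : E → ℝ × E → ℝ≥0∞)) := by
  unfold bump Function.uncurry
  fun_prop

lemma integrable_exp_neg_mul_sq_norm {b : ℝ} (hb : 0 < b) :
    Integrable fun z : E => Real.exp (-b * ‖z‖ ^ 2) := by
  refine Integrable.of_integral_ne_zero ?_
  rw [GaussianFourier.integral_rexp_neg_mul_sq_norm hb]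
  positivity

lemma lintegral_exp_neg_mul_sq_norm {b : ℝ} (hb : 0 < b) :
    ∫⁻ z : E, ENNReal.ofReal (Real.exp (-b * ‖z‖ ^ 2))
      = ENNReal.ofReal ((Real.pi / b) ^ (Module.finrank ℝ E / 2 : ℝ)) := by
  rw [← GaussianFourier.integral_rexp_neg_mul_sq_norm hb, ofReal_integral_eq_lintegral_ofReal
    (integrable_exp_neg_mul_sq_norm hb) (Eventually.of_forall fun z => (Real.exp_pos _).le)]

/-- By the parallelogram law, `2|x-z|² + 2|y-z|² = |x-y|² + 4|z-(x+y)/2|²`; the second term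
integrates to a constant independent of `x` and `y`. -/
lemma lintegral_bump_mul_bump {s : ℝ} (hs : 0 < s) (x y : E) :
    ∫⁻ z, bump x (s, z) * bump y (s, z)
      = ENNReal.ofReal (Real.exp (-s * ‖x - y‖ ^ 2))
        * ENNReal.ofReal ((Real.pi / (4 * s)) ^ (Module.finrank ℝ E / 2 : ℝ)) := by
  have h : ∀ z : E, bump x (s, z) * bump y (s, z)
      = ENNReal.ofReal (Real.exp (-s * ‖x - y‖ ^ 2))
        * ENNReal.ofReal (Real.exp (-(4 * s) * ‖z - (2⁻¹ : ℝ) • (x + y)‖ ^ 2)) := by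
    intro z
    unfold bump
    rw [← ENNReal.ofReal_mul (Real.exp_pos _).le, ← ENNReal.ofReal_mul (Real.exp_pos _).le,
      ← Real.exp_add, ← Real.exp_add]
    congr 2
    have h1 := parallelogram_law_with_norm ℝ (x - z) (y - z)
    have h2 : (x - z) + (y - z) = (-2 : ℝ) • (z - (2⁻¹ : ℝ) • (x + y)) := by
      module
    have h3 : (x - z) - (y - z) = x - y := by abel
    rw [h2, h3, norm_smul, show ‖(-2 : ℝ)‖ = 2 by norm_num] at h1
    linear_combination s * h1
  simp_rw [h]
  rw [lintegral_const_mul _ (by fun_prop),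
    lintegral_sub_right_eq_self
      (fun z : E => ENNReal.ofReal (Real.exp (-(4 * s) * ‖z‖ ^ 2))),
    lintegral_exp_neg_mul_sq_norm (by positivity)]

lemma lintegral_rpow_mul_exp_neg {p u : ℝ} (hp : 0 < p) (hu : 0 ≤ u) :
    ∫⁻ s in Set.Ioi (0 : ℝ), ENNReal.ofReal (s ^ (p - 1) * Real.exp (-(u * s)))
      = ENNReal.ofReal u ^ (-p) * ENNReal.ofReal (Real.Gamma p) := by
  have hG := Real.Gamma_pos_of_pos hp
  -- At `u = 0` both sides are infinite: no power of `s` is integrable on the whole half-line.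
  rcases hu.eq_or_lt with rfl | hu
  · simp only [zero_mul, neg_zero, Real.exp_zero, mul_one, ENNReal.ofReal_zero]
    rw [ENNReal.zero_rpow_of_neg (by linarith), ENNReal.top_mul (by simpa using hG)]
    by_contra hne
    refine not_integrableOn_Ioi_rpow (p - 1) ?_
    refine (lintegral_ofReal_ne_top_iff_integrable (by fun_prop) ?_).1 hne
    filter_upwards [ae_restrict_mem measurableSet_Ioi] with s hs
    exact Real.rpow_nonneg (le_of_lt hs) _
  · have h := Real.integral_rpow_mul_exp_neg_mul_Ioi hp hu
    have hpos : 0 < (1 / u) ^ p * Real.Gamma p := by positivity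
    rw [← ofReal_integral_eq_lintegral_ofReal, h, ENNReal.ofReal_mul (by positivity),
      ENNReal.ofReal_rpow_of_pos hu, one_div, Real.inv_rpow hu.le, Real.rpow_neg hu.le]
    · exact Integrable.of_integral_ne_zero (by rw [h]; exact hpos.ne')
    · filter_upwards [ae_restrict_mem measurableSet_Ioi] with s hs
      exact mul_nonneg (Real.rpow_nonneg (le_of_lt hs) _) (Real.exp_pos _).le

/-- The density in the scale variable for the Gaussian superposition of the Riesz kernel. -/
noncomputable def scaleDensity (d : ℕ) (q s : ℝ) : ℝ≥0∞ :=
  ENNReal.ofReal (s ^ (q / 2 - 1) / (Real.Gamma (q / 2) * (Real.pi / (4 * s)) ^ (d / 2 : ℝ)))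

lemma measurable_scaleDensity (d : ℕ) (q : ℝ) : Measurable (scaleDensity d q) := by
  unfold scaleDensity
  fun_prop

variable (E) in
/-- The measure on scales and centres for the Gaussian superposition of the Riesz kernel. -/
noncomputable def scaleMeasure (q : ℝ) : Measure (ℝ × E) :=
  ((volume.restrict (Set.Ioi 0)).withDensity (scaleDensity (Module.finrank ℝ E) q)).prod volume

instance (q : ℝ) : SFinite (scaleMeasure E q) := by
  unfold scaleMeasure; infer_instance

/-- This makes `bump` a feature map for the Riesz kernel. The density cancels the Gaussian
normalization in the centre, leaving the Gamma integral with exponent `q/2` at `|x-y|²`; the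
diagonal is included, with value `⊤`. -/
lemma edist_rpow_neg_eq_lintegral_bump {q : ℝ} (hq : 0 < q) (x y : E) :
    edist x y ^ (-q) = ∫⁻ p, bump x p * bump y p ∂(scaleMeasure E q) := by
  have hG := Real.Gamma_pos_of_pos (half_pos hq)
  have hm : Measurable fun p : ℝ × E => bump x p * bump y p := by unfold bump; fun_prop
  have hm1 : Measurable fun s : ℝ => ∫⁻ z : E, bump x (s, z) * bump y (s, z) :=
    hm.lintegral_prod_right'
  rw [scaleMeasure, lintegral_prod _ hm.aemeasurable,
    lintegral_withDensity_eq_lintegral_mul _ (measurable_scaleDensity _ _) hm1]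
  have h : ∀ s ∈ Set.Ioi (0 : ℝ),
      (scaleDensity (Module.finrank ℝ E) q * fun s => ∫⁻ z : E, bump x (s, z) * bump y (s, z)) s
      = ENNReal.ofReal (s ^ (q / 2 - 1) * Real.exp (-(‖x - y‖ ^ 2 * s)))
        * ENNReal.ofReal (Real.Gamma (q / 2))⁻¹ := by
    intro s hs
    have hs : 0 < s := hs
    simp only [Pi.mul_apply]
    rw [lintegral_bump_mul_bump hs, scaleDensity, ← ENNReal.ofReal_mul (Real.exp_pos _).le,
      ← ENNReal.ofReal_mul (by positivity), ← ENNReal.ofReal_mul (by positivity)]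
    congr 1
    have : 0 < (Real.pi / (4 * s)) ^ (Module.finrank ℝ E / 2 : ℝ) := by positivity
    field_simp
  rw [setLIntegral_congr_fun measurableSet_Ioi h, lintegral_mul_const _ (by fun_prop),
    lintegral_rpow_mul_exp_neg (half_pos hq) (by positivity), mul_assoc,
    ← ENNReal.ofReal_mul hG.le, mul_inv_cancel₀ hG.ne', ENNReal.ofReal_one, mul_one,
    edist_dist, dist_eq_norm, ENNReal.ofReal_pow (norm_nonneg _), ← ENNReal.rpow_natCast,
    ← ENNReal.rpow_mul]
  congr 1
  push_cast
  ring

/-- The Fourier transform of the potential of a finite measure under a Gaussian. -/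
lemma integral_exp_inner_mul_potential {s : ℝ} (hs : 0 < s) (μ : Measure E)
    [IsFiniteMeasure μ] (ξ : E) :
    ∫ z : E, Complex.exp (inner ℝ z ξ * Complex.I) * ((∫⁻ x, bump x (s, z) ∂μ).toReal : ℂ)
      = charFun μ ξ *
        ∫ z : E, Complex.exp (inner ℝ z ξ * Complex.I) * (Real.exp (-(2 * s) * ‖z‖ ^ 2) : ℂ) := by
  have hU : ∀ z : E, ((∫⁻ x, bump x (s, z) ∂μ).toReal : ℂ)
      = ∫ x, (Real.exp (-(2 * s) * ‖x - z‖ ^ 2) : ℂ) ∂μ := by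
    intro z
    rw [integral_complex_ofReal, integral_eq_lintegral_of_nonneg_ae
      (Eventually.of_forall fun x => (Real.exp_pos _).le)
      (by fun_prop)]
    rfl
  simp_rw [hU]
  rw [integral_congr_ae (Eventually.of_forall fun z => (integral_const_mul _ _).symm)]
  have hgi := integrable_exp_neg_mul_sq_norm (E := E) (b := 2 * s) (by positivity)
  have hint : Integrable (Function.uncurry fun (x z : E) =>
      Complex.exp (inner ℝ z ξ * Complex.I) * (Real.exp (-(2 * s) * ‖x - z‖ ^ 2) : ℂ))
      (μ.prod volume) := by
    have hc : Continuous (Function.uncurry fun (x z : E) =>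
      Complex.exp (inner ℝ z ξ * Complex.I) * (Real.exp (-(2 * s) * ‖x - z‖ ^ 2) : ℂ)) := by
      unfold Function.uncurry; fun_prop
    rw [integrable_prod_iff hc.aestronglyMeasurable]
    have hn : ∀ x z : E, ‖Complex.exp (inner ℝ z ξ * Complex.I)
        * (Real.exp (-(2 * s) * ‖x - z‖ ^ 2) : ℂ)‖ = Real.exp (-(2 * s) * ‖z - x‖ ^ 2) := by
      intro x z
      rw [norm_mul, Complex.norm_exp_ofReal_mul_I, one_mul, Complex.norm_real,
        Real.norm_of_nonneg (Real.exp_pos _).le, norm_sub_rev]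
    refine ⟨Eventually.of_forall fun x => ?_, ?_⟩
    · refine (hgi.comp_sub_right x).mono' (by
        unfold Function.uncurry; exact Continuous.aestronglyMeasurable (by fun_prop)) ?_
      exact Eventually.of_forall fun z => (hn x z).le
    · simp only [Function.uncurry, hn]
      have : ∀ x : E, ∫ z : E, Real.exp (-(2 * s) * ‖z - x‖ ^ 2)
          = ∫ z : E, Real.exp (-(2 * s) * ‖z‖ ^ 2) := fun x =>
        integral_sub_right_eq_self (fun z : E => Real.exp (-(2 * s) * ‖z‖ ^ 2)) x
      simp_rw [this]
      exact integrable_const _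
  rw [← integral_integral_swap hint, charFun_apply, ← integral_mul_const]
  refine integral_congr_ae (Eventually.of_forall fun x => ?_)
  simp only
  -- After translating `z` by `x` the phase splits off `exp(i⟨x,ξ⟩)`, whose integral is the
  -- characteristic function.
  rw [← integral_add_right_eq_self _ x, ← integral_const_mul]
  refine integral_congr_ae (Eventually.of_forall fun z => ?_)
  simp only
  rw [inner_add_left, show x - (z + x) = -z by abel, norm_neg]
  push_cast
  rw [add_mul, Complex.exp_add]
  ring

/-- The Fourier transform of a Gaussian has no zeros, so it can be cancelled to recover `charFun`.
-/
lemma integral_exp_inner_mul_exp_ne_zero {s : ℝ} (hs : 0 < s) (ξ : E) :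
    ∫ z : E, Complex.exp (inner ℝ z ξ * Complex.I) * (Real.exp (-(2 * s) * ‖z‖ ^ 2) : ℂ) ≠ 0 := by
  have h := GaussianFourier.integral_cexp_neg_mul_sq_norm_add (V := E) (b := ((2 * s : ℝ) : ℂ))
    (by simpa using hs) Complex.I ξ
  have h2 : ∀ z : E, Complex.exp (inner ℝ z ξ * Complex.I)
      * (Real.exp (-(2 * s) * ‖z‖ ^ 2) : ℂ)
      = Complex.exp (-((2 * s : ℝ) : ℂ) * ‖z‖ ^ 2 + Complex.I * inner ℝ ξ z) := by
    intro z
    rw [Complex.ofReal_exp, ← Complex.exp_add, real_inner_comm]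
    congr 1
    push_cast
    ring
  simp_rw [h2]
  rw [h]
  refine mul_ne_zero ?_ (Complex.exp_ne_zero _)
  rw [← Complex.ofReal_div]
  intro h0
  have := (Complex.cpow_eq_zero_iff _ _).1 h0
  have hpos : (0 : ℝ) < Real.pi / (2 * s) := by positivity
  exact hpos.ne' (by exact_mod_cast this.1)

/-- A finite measure is determined by its potentials under Gaussians of one scale. -/
lemma eq_of_potential_ae_eq {s : ℝ} (hs : 0 < s) {μ ν : Measure E}
    [IsFiniteMeasure μ] [IsFiniteMeasure ν]
    (h : ∀ᵐ z : E, ∫⁻ x, bump x (s, z) ∂μ = ∫⁻ x, bump x (s, z) ∂ν) : μ = ν := by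
  refine Measure.ext_of_charFun (funext fun ξ => ?_)
  refine mul_right_cancel₀ (integral_exp_inner_mul_exp_ne_zero hs ξ) ?_
  rw [← integral_exp_inner_mul_potential hs μ, ← integral_exp_inner_mul_potential hs ν]
  refine integral_congr_ae ?_
  filter_upwards [h] with z hz
  rw [hz]

/-- Two measures of Riesz energy at most `V < ∞` whose midpoint has energy at least `V` agree. -/
lemma eq_of_riesz_midpoint {q : ℝ} (hq : 0 < q) {μ ν : Measure E}
    [IsFiniteMeasure μ] [IsFiniteMeasure ν] {V : ℝ≥0∞} (hV : V ≠ ⊤)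
    (hμ : ∫⁻ x, ∫⁻ y, edist x y ^ (-q) ∂μ ∂μ ≤ V) (hν : ∫⁻ x, ∫⁻ y, edist x y ^ (-q) ∂ν ∂ν ≤ V)
    (hμν : V ≤ ∫⁻ x, ∫⁻ y, edist x y ^ (-q)
      ∂((2⁻¹ : ℝ≥0∞) • (μ + ν)) ∂((2⁻¹ : ℝ≥0∞) • (μ + ν))) : μ = ν := by
  have h := feature_ae_eq measurable_bump (edist_rpow_neg_eq_lintegral_bump hq) hV hμ hν hμν
  have h1 := Measure.ae_ae_of_ae_prod h
  rw [ae_withDensity_iff (measurable_scaleDensity _ _),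
    ae_restrict_iff' measurableSet_Ioi] at h1
  obtain ⟨s, hs, hs1⟩ : ∃ s : ℝ, 0 < s ∧ (s ∈ Set.Ioi (0 : ℝ) →
      scaleDensity (Module.finrank ℝ E) q s ≠ 0 →
        ∀ᵐ z : E, ∫⁻ x, bump x (s, z) ∂μ = ∫⁻ x, bump x (s, z) ∂ν) := by
    -- Equality for almost every scale yields one positive scale, and one scale determines the
    -- measure.
    have hf : ∃ᵐ s : ℝ, s ∈ Set.Ioi (0 : ℝ) := by
      rw [frequently_ae_mem_iff]
      simp
    obtain ⟨s, hs⟩ := (hf.and_eventually h1).exists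
    exact ⟨s, hs.1, hs.2⟩
  refine eq_of_potential_ae_eq hs (hs1 hs ?_)
  have hG := Real.Gamma_pos_of_pos (half_pos hq)
  unfold scaleDensity
  simp only [ne_eq, ENNReal.ofReal_eq_zero, not_le]
  positivity

end Gaussian

/-! ### Expansion of the reflection series, with explicit error terms. -/

section Series

/-- With `y = p log(1+x)`, combine `x - x² ≤ log(1+x) ≤ x` with `1 - y ≤ e^{-y} ≤ 1 - y + y²` for `y
≥ 0`. An error valid for all `x ≥ 0` can be summed over the reflections. -/
lemma one_add_rpow_neg_bounds {p x : ℝ} (hp : 0 < p) (hx : 0 ≤ x) :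
    1 - p * x ≤ (1 + x) ^ (-p) ∧ (1 + x) ^ (-p) ≤ 1 - p * x + (p + p ^ 2) * x ^ 2 := by
  have h1 : (0 : ℝ) < 1 + x := by linarith
  set y := p * Real.log (1 + x) with hy
  have he : (1 + x) ^ (-p) = Real.exp (-y) := by
    rw [Real.rpow_def_of_pos h1, hy]; congr 1; ring
  have hlog1 : Real.log (1 + x) ≤ x := by linarith [Real.log_le_sub_one_of_pos h1]
  have hlog2 : x - x ^ 2 ≤ Real.log (1 + x) := by
    refine le_trans ?_ (Real.one_sub_inv_le_log_of_pos h1)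
    rw [← sub_nonneg]
    have : 1 - (1 + x)⁻¹ - (x - x ^ 2) = x ^ 3 / (1 + x) := by field_simp; ring
    rw [this]; positivity
  have hlog0 : 0 ≤ Real.log (1 + x) := Real.log_nonneg (by linarith)
  have hy0 : 0 ≤ y := by positivity
  have hyx : y ≤ p * x := by rw [hy]; gcongr
  rw [he]
  constructor
  · linarith [Real.add_one_le_exp (-y)]
  · have hexp : Real.exp (-y) ≤ 1 - y + y ^ 2 := by
      rw [Real.exp_neg]
      refine inv_le_of_inv_le₀ (by nlinarith [sq_nonneg (y - 1)]) ?_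
      refine le_trans ?_ (Real.add_one_le_exp y)
      rw [inv_le_iff_one_le_mul₀ (by nlinarith [sq_nonneg (y - 1)])]
      -- Since `e^y ≥ 1 + y`, the upper bound for `e^{-y}` reduces to `1 + y³ ≥ 1`.
      have : (y + 1) * (1 - y + y ^ 2) = 1 + y ^ 3 := by ring
      rw [this]
      have : 0 ≤ y ^ 3 := by positivity
      linarith
    have h2 : p * (x - x ^ 2) ≤ y := by rw [hy]; gcongr
    have h3 : y ^ 2 ≤ (p * x) ^ 2 := by gcongr
    nlinarith

/-- The increment of `v ↦ v ^ (-q/2)` from `b²` to `u + b²`. -/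
noncomputable def increment (q b u : ℝ) : ℝ := (u + b ^ 2) ^ (-(q / 2)) - b ^ (-q)

/-- Factor out `b^{-q}` and expand in `x = u/b²` with exponent `q/2`. -/
lemma increment_bounds {q b u : ℝ} (hq : 0 < q) (hb : 0 < b) (hu : 0 ≤ u) :
    -(q / 2) * u * b ^ (-(q + 2)) ≤ increment q b u ∧ increment q b u ≤ 0 ∧
    increment q b u ≤ -(q / 2) * u * b ^ (-(q + 2))
      + (q / 2 + (q / 2) ^ 2) * u ^ 2 * b ^ (-(q + 4)) := by
  have hx : 0 ≤ u / b ^ 2 := by positivity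
  obtain ⟨h1, h2⟩ := one_add_rpow_neg_bounds (half_pos hq) hx
  have h0 : (1 + u / b ^ 2) ^ (-(q / 2)) ≤ 1 :=
    Real.rpow_le_one_of_one_le_of_nonpos (by linarith) (by linarith)
  have hs : (b ^ 2) ^ (-(q / 2)) = b ^ (-q) := by
    rw [← Real.rpow_natCast, ← Real.rpow_mul hb.le]; congr 1; push_cast; ring
  have hf : (u + b ^ 2) ^ (-(q / 2)) = b ^ (-q) * (1 + u / b ^ 2) ^ (-(q / 2)) := by
    rw [← hs, ← Real.mul_rpow (by positivity) (by positivity)]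
    congr 1; field_simp; ring
  have hb2 : b ^ (-(q + 2)) = b ^ (-q) / b ^ 2 := by
    rw [← Real.rpow_natCast, ← Real.rpow_sub hb]; congr 1; push_cast; ring
  have hb4 : b ^ (-(q + 4)) = b ^ (-q) / b ^ 4 := by
    rw [← Real.rpow_natCast, ← Real.rpow_sub hb]; congr 1; push_cast; ring
  have hpos : 0 < b ^ (-q) := Real.rpow_pos_of_pos hb _
  rw [increment, hf, hb2, hb4]
  have h1' := mul_le_mul_of_nonneg_left h1 hpos.le
  have h2' := mul_le_mul_of_nonneg_left h2 hpos.le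
  have h0' := mul_le_mul_of_nonneg_left h0 hpos.le
  have e1 : b ^ (-q) * (1 - q / 2 * (u / b ^ 2))
    = b ^ (-q) + -(q / 2) * u * (b ^ (-q) / b ^ 2) := by ring
  have e2 : b ^ (-q) * (1 - q / 2 * (u / b ^ 2) + (q / 2 + (q / 2) ^ 2) * (u / b ^ 2) ^ 2)
    = b ^ (-q) + (-(q / 2) * u * (b ^ (-q) / b ^ 2)
      + (q / 2 + (q / 2) ^ 2) * u ^ 2 * (b ^ (-q) / b ^ 4)) := by
    field_simp; ring
  rw [e1] at h1'
  rw [e2] at h2'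
  refine ⟨by linarith, by linarith, by linarith⟩

lemma hasSum_riemannZeta_re {s : ℝ} (hs : 1 < s) :
    HasSum (fun n : ℕ => ((n : ℝ) + 1) ^ (-s)) (riemannZeta (s : ℂ)).re := by
  have hsum : Summable fun n : ℕ => ((n : ℝ) + 1) ^ (-s) := by
    have := (summable_nat_add_iff 1).2 (Real.summable_nat_rpow.2 (show -s < -1 by linarith))
    simpa using this
  have h := zeta_eq_tsum_one_div_nat_add_one_cpow (s := (s : ℂ)) (by simpa using hs)
  have h2 : ∀ n : ℕ, 1 / ((n : ℂ) + 1) ^ (s : ℂ) = ((((n : ℝ) + 1) ^ (-s) : ℝ) : ℂ) := by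
    intro n
    rw [Real.rpow_neg (by positivity), Complex.ofReal_inv, Complex.ofReal_cpow (by positivity),
      one_div]
    push_cast; rfl
  simp_rw [h2] at h
  rw [h, ← Complex.ofReal_tsum, Complex.ofReal_re]
  exact hsum.hasSum

lemma hasSum_mul_nat_add_one_rpow {s t : ℝ} (hs : 1 < s) (ht : 0 < t) :
    HasSum (fun n : ℕ => (2 * t * ((n : ℝ) + 1)) ^ (-s))
      ((2 * t) ^ (-s) * (riemannZeta (s : ℂ)).re) := by
  have := (hasSum_riemannZeta_re hs).mul_left ((2 * t) ^ (-s))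
  refine this.congr_fun fun n => ?_
  rw [Real.mul_rpow (by positivity) (by positivity)]

/-- The part of the strip kernel that varies with the squared distance `u`, apart from the
Riesz kernel. -/
noncomputable def reflectionPart (q t u : ℝ) : ℝ :=
  2 * ∑' n : ℕ, increment q (2 * t * ((n : ℝ) + 1)) u

lemma abs_increment_le {q b u R : ℝ} (hq : 0 < q) (hb : 0 < b) (hu : 0 ≤ u) (huR : u ≤ R) :
    |increment q b u| ≤ q / 2 * R * b ^ (-(q + 2)) := by
  obtain ⟨h1, h2, -⟩ := increment_bounds hq hb hu
  have : q / 2 * u * b ^ (-(q + 2)) ≤ q / 2 * R * b ^ (-(q + 2)) := by gcongr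
  rw [abs_of_nonpos h2]
  linarith

/-- Subtracting `b^{-q}` leaves terms of order `b^{-(q+2)}`, which makes the series converge also at
`q = 1`. -/
lemma summable_increment {q t u : ℝ} (hq : 0 < q) (ht : 0 < t) (hu : 0 ≤ u) :
    Summable fun n : ℕ => increment q (2 * t * ((n : ℝ) + 1)) u :=
  Summable.of_norm_bounded
    ((hasSum_mul_nat_add_one_rpow (s := q + 2) (by linarith) ht).summable.mul_left (q / 2 * u))
    fun n => abs_increment_le hq (by positivity) hu le_rfl

lemma continuousOn_reflectionPart {q t R : ℝ} (hq : 0 < q) (ht : 0 < t) :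
    ContinuousOn (reflectionPart q t) (Set.Icc 0 R) := by
  refine ContinuousOn.mul continuousOn_const (continuousOn_tsum (fun n => ?_)
    ((hasSum_mul_nat_add_one_rpow (s := q + 2) (by linarith) ht).summable.mul_left (q / 2 * R))
    fun n u hu => abs_increment_le hq (by positivity) hu.1 hu.2)
  refine ContinuousOn.sub (ContinuousOn.rpow_const (by fun_prop) fun u hu => Or.inl ?_)
    continuousOn_const
  have : 0 < (2 * t * ((n : ℝ) + 1)) ^ 2 := by positivity
  linarith [hu.1]

/-- The second-order expansion of the reflection part for wide strips. -/
lemma reflectionPart_bounds {q t u : ℝ} (hq : 0 < q) (ht : 0 < t) (hu : 0 ≤ u) :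
    -(coeffB q * (2 * t) ^ (-(q + 2))) * u ≤ reflectionPart q t u ∧
    reflectionPart q t u ≤ -(coeffB q * (2 * t) ^ (-(q + 2))) * u
      + (q + q ^ 2 / 2) * (riemannZeta ((q + 4 : ℝ) : ℂ)).re * u ^ 2 * (2 * t) ^ (-(q + 4)) := by
  have h2 := (hasSum_mul_nat_add_one_rpow (s := q + 2) (by linarith) ht).mul_left (-(q / 2) * u)
  have h4 := (hasSum_mul_nat_add_one_rpow (s := q + 4) (by linarith) ht).mul_left
    ((q / 2 + (q / 2) ^ 2) * u ^ 2)
  have hs := (summable_increment hq ht hu).hasSum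
  have hb := fun n : ℕ => increment_bounds (u := u) hq
    (show (0 : ℝ) < 2 * t * ((n : ℝ) + 1) by positivity) hu
  have l1 := hasSum_le (fun n => (hb n).1) h2 hs
  have l2 := hasSum_le (fun n => (hb n).2.2) hs (h2.add h4)
  rw [reflectionPart, coeffB]
  refine ⟨by linear_combination 2 * l1, by linear_combination 2 * l2⟩

end Series

/-! ### The strip kernel on the central hyperplane. -/

section Kernel

variable {n : ℕ}

lemma dist_point_rho (t : ℝ) (j : ℤ) (x y : EuclideanSpace ℝ (Fin n)) :
    dist (point x 0) (rho t j (point y 0)) = √(dist x y ^ 2 + (2 * t * j) ^ 2) := by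
  rw [WithLp.prod_dist_eq_of_L2]
  simp [point, rho, Real.dist_eq, mul_pow]

lemma point_eq_rho_iff (t : ℝ) (x y : EuclideanSpace ℝ (Fin n)) :
    (∃ j : ℤ, point x 0 = rho t j (point y 0)) ↔ x = y := by
  constructor
  · rintro ⟨j, hj⟩
    have := dist_point_rho t j x y
    rw [hj, dist_self, eq_comm, Real.sqrt_eq_zero (by positivity)] at this
    have h0 : dist x y ^ 2 = 0 := by nlinarith [sq_nonneg (dist x y), sq_nonneg (2 * t * j)]
    exact dist_eq_zero.1 (by simpa using h0)
  · rintro rfl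
    exact ⟨0, by simp [rho, point]⟩

lemma one_div_sqrt_rpow {q v : ℝ} (hv : 0 ≤ v) : 1 / √v ^ q = v ^ (-(q / 2)) := by
  rw [Real.sqrt_eq_rpow, ← Real.rpow_mul hv, one_div, ← Real.rpow_neg hv]
  congr 1; ring

/-- The term `j = 0` is the Riesz kernel. For `q > 1` the constants `|2tj|^{-q}` removed from the
others sum to `2ζ(q)/(2t)^q`; for `q = 1` the definition already removes them and its explicit
constant equals `A_1(t)/(2t)`. -/
lemma stripKernel_point {q t : ℝ} (hq : 1 ≤ q) (ht : 0 < t)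
    (x y : EuclideanSpace ℝ (Fin n)) :
    stripKernel q t (point x 0) (point y 0) = ((edist x y ^ (-q) : ℝ≥0∞) : EReal)
      + ((coeffA q t / (2 * t) ^ q + reflectionPart q t (dist x y ^ 2) : ℝ) : EReal) := by
  have hq0 : 0 < q := by linarith
  rw [stripKernel]
  simp only [point_eq_rho_iff t]
  by_cases hxy : x = y
  · subst hxy
    rw [if_pos rfl, edist_self, ENNReal.zero_rpow_of_neg (by linarith)]
    exact (EReal.top_add_coe _).symm
  rw [if_neg hxy]
  have hr : 0 < dist x y := dist_pos.2 hxy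
  have hed : ((edist x y ^ (-q) : ℝ≥0∞) : EReal) = ((dist x y ^ (-q) : ℝ) : EReal) := by
    rw [edist_dist, ENNReal.ofReal_rpow_of_pos hr, EReal.coe_ennreal_ofReal,
      max_eq_left (by positivity)]
  have hsum := (summable_increment hq0 ht (sq_nonneg (dist x y))).hasSum
  rw [hed, ← EReal.coe_add]
  have hterm : ∀ m : ℕ, increment q (2 * t * ((m : ℝ) + 1)) (dist x y ^ 2)
      = 1 / √(dist x y ^ 2 + (2 * t * ((m : ℝ) + 1)) ^ 2) ^ q
        - (2 * t * ((m : ℝ) + 1)) ^ (-q) := fun m => by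
    rw [increment, one_div_sqrt_rpow (by positivity)]
  split_ifs with h1
  · subst h1
    rw [coeffA, if_pos rfl]
    congr 1
    -- Extension by zero at `j = 0` turns the subtype sum into a sum over `ℤ`, which splits into `j
    -- ≥ 1` and `j ≤ -1`.
    let f : ℤ → ℝ := ({j : ℤ | j ≠ 0} : Set ℤ).indicator fun j =>
      1 / dist (point x 0) (rho t j (point y 0)) - 1 / |2 * t * (j : ℝ)|
    have hf : ∀ m : ℕ, f (m + 1) = increment 1 (2 * t * ((m : ℝ) + 1)) (dist x y ^ 2) := by
      intro m
      have hm : ((m : ℤ) + 1) ∈ {j : ℤ | j ≠ 0} := by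
        simp only [Set.mem_ofPred_eq]; positivity
      simp only [f]
      rw [Set.indicator_of_mem hm, hterm, dist_point_rho, Real.rpow_one, Real.rpow_neg_one,
        abs_of_pos (by push_cast; positivity)]
      push_cast
      rw [one_div (2 * t * ((m : ℝ) + 1))]
    have hf' : ∀ m : ℕ, f (-(m + 1)) = increment 1 (2 * t * ((m : ℝ) + 1)) (dist x y ^ 2) := by
      intro m
      rw [← hf]
      have hm : ((m : ℤ) + 1) ∈ {j : ℤ | j ≠ 0} := by
        simp only [Set.mem_ofPred_eq]; positivity
      have hm' : -((m : ℤ) + 1) ∈ {j : ℤ | j ≠ 0} := by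
        simp only [Set.mem_ofPred_eq, neg_ne_zero]; positivity
      simp only [f]
      rw [Set.indicator_of_mem hm, Set.indicator_of_mem hm', dist_point_rho, dist_point_rho]
      push_cast
      rw [mul_neg, neg_sq, abs_neg]
    have h0 : f 0 = 0 := by simp [f]
    have H := HasSum.of_add_one_of_neg_add_one (f := f)
      (by simp_rw [hf]; exact hsum) (by simp_rw [hf']; exact hsum)
    have H' : ∑' j : {j : ℤ // j ≠ 0}, (1 / dist (point x 0) (rho t j (point y 0))
        - 1 / |2 * t * ((j : ℤ) : ℝ)|) = reflectionPart 1 t (dist x y ^ 2) := by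
      rw [h0, add_zero, ← two_mul] at H
      rw [reflectionPart, ← H.tsum_eq]
      exact tsum_subtype {j : ℤ | j ≠ 0} fun j =>
        1 / dist (point x 0) (rho t j (point y 0)) - 1 / |2 * t * (j : ℝ)|
    have hd : dist (point x 0) (point y 0) = dist x y := by
      have := dist_point_rho t 0 x y
      rw [show rho t 0 (point y 0) = point y 0 by simp [rho, point]] at this
      rw [this]
      simp [Real.sqrt_sq hr.le]
    rw [H', hd, Real.rpow_neg_one, Real.rpow_one]
    field_simp
    ring
  · have hq1 : 1 < q := lt_of_le_of_ne hq (Ne.symm h1)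
    rw [coeffA, if_neg h1]
    congr 1
    simp_rw [dist_point_rho]
    let f : ℤ → ℝ := fun j => 1 / √(dist x y ^ 2 + (2 * t * (j : ℝ)) ^ 2) ^ q
    have hz := hasSum_mul_nat_add_one_rpow hq1 ht
    have hs : HasSum (fun m : ℕ => 1 / √(dist x y ^ 2 + (2 * t * ((m : ℝ) + 1)) ^ 2) ^ q)
        ((∑' m : ℕ, increment q (2 * t * ((m : ℝ) + 1)) (dist x y ^ 2))
          + (2 * t) ^ (-q) * (riemannZeta (q : ℂ)).re) := by
      refine (hsum.add hz).congr_fun fun m => ?_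
      rw [hterm]; ring
    have H := HasSum.of_add_one_of_neg_add_one (f := f)
      (m := (∑' m : ℕ, increment q (2 * t * ((m : ℝ) + 1)) (dist x y ^ 2))
          + (2 * t) ^ (-q) * (riemannZeta (q : ℂ)).re)
      (m' := (∑' m : ℕ, increment q (2 * t * ((m : ℝ) + 1)) (dist x y ^ 2))
          + (2 * t) ^ (-q) * (riemannZeta (q : ℂ)).re)
      (by simp only [f]; push_cast; exact hs)
      (by simp only [f]; push_cast; simp only [mul_neg, neg_sq]; exact hs)
    have h0 : f 0 = dist x y ^ (-q) := by
      simp only [f]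
      rw [Int.cast_zero, mul_zero, zero_pow two_ne_zero, add_zero, Real.sqrt_sq hr.le, one_div,
        Real.rpow_neg hr.le]
    rw [H.tsum_eq, h0, reflectionPart, Real.rpow_neg (by positivity : (0 : ℝ) ≤ 2 * t)]
    ring

end Kernel

/-! ### Pushforward of energies and arithmetic of positive and negative parts. -/

section Transport

variable {C X : Type*} [MeasurableSpace C] [MeasurableSpace X]

lemma kernelEnergy_map {f : C → X} (hf : MeasurableEmbedding f) (G : X → X → EReal)
    (μ : Measure C) :
    kernelEnergy G (μ.map f) = kernelEnergy (fun a b => G (f a) (f b)) μ := by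
  unfold kernelEnergy
  simp_rw [hf.lintegral_map]

lemma isProbOn_range_iff {f : C → X} (hf : MeasurableEmbedding f) (ν : Measure X) :
    IsProbOn (Set.range f) ν ↔ ∃ μ : ProbabilityMeasure C, (μ : Measure C).map f = ν := by
  constructor
  · rintro ⟨h1, h2⟩
    have hm : (ν.comap f).map f = ν := by
      rw [hf.map_comap, Measure.restrict_eq_self_of_ae_mem]
      exact h2
    refine ⟨⟨ν.comap f, ⟨?_⟩⟩, hm⟩
    rw [hf.comap_apply, Set.image_univ, ← measure_univ (μ := ν)]
    exact measure_of_measure_compl_eq_zero h2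
  · rintro ⟨μ, rfl⟩
    refine ⟨Measure.isProbabilityMeasure_map hf.measurable.aemeasurable, ?_⟩
    rw [hf.map_apply]
    simp

/-- One of `h⁺`, `h⁻` vanishes, so truncated subtraction gives exactly the positive part of `k + h`.
-/
lemma toENNReal_coe_add_coe (k : ℝ≥0∞) (h : ℝ) :
    ((k : EReal) + (h : EReal)).toENNReal = k + ENNReal.ofReal h - ENNReal.ofReal (-h) := by
  rcases eq_or_ne k ⊤ with rfl | hk
  · simp
  lift k to ℝ≥0 using hk
  have : ((k : ℝ≥0∞) : EReal) + (h : EReal) = (((k : ℝ) + h : ℝ) : EReal) := by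
    rw [EReal.coe_add]; rfl
  rw [this, EReal.toENNReal_of_ne_top (EReal.coe_ne_top _), EReal.toReal_coe,
    ← ENNReal.ofReal_coe_nnreal]
  rcases le_total 0 h with h0 | h0
  · rw [ENNReal.ofReal_of_nonpos (neg_nonpos.2 h0), tsub_zero, ENNReal.ofReal_add k.coe_nonneg h0]
  · rw [ENNReal.ofReal_of_nonpos h0, add_zero, ← ENNReal.ofReal_sub _ (neg_nonneg.2 h0),
      sub_neg_eq_add]

lemma toENNReal_neg_coe_add_coe (k : ℝ≥0∞) (h : ℝ) :
    (-((k : EReal) + (h : EReal))).toENNReal = ENNReal.ofReal (-h) - k := by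
  rcases eq_or_ne k ⊤ with rfl | hk
  · simp
  lift k to ℝ≥0 using hk
  have : ((k : ℝ≥0∞) : EReal) + (h : EReal) = (((k : ℝ) + h : ℝ) : EReal) := by
    rw [EReal.coe_add]; rfl
  rw [this, ← EReal.coe_neg, EReal.toENNReal_of_ne_top (EReal.coe_ne_top _), EReal.toReal_coe,
    ← ENNReal.ofReal_coe_nnreal, ← ENNReal.ofReal_sub _ k.coe_nonneg]
  congr 1; ring

/-- This is `(k+h)⁺ + h⁻ = k + h⁺ + (k+h)⁻`, rearranged so that it can be integrated even where `k`
is infinite. -/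
lemma add_ofReal_decomp (k : ℝ≥0∞) (h : ℝ) :
    (k + ENNReal.ofReal h - ENNReal.ofReal (-h)) + ENNReal.ofReal (-h)
      = k + ENNReal.ofReal h + (ENNReal.ofReal (-h) - k) := by
  rcases le_total 0 h with h0 | h0
  · rw [ENNReal.ofReal_of_nonpos (neg_nonpos.2 h0)]; simp
  · rw [ENNReal.ofReal_of_nonpos h0, add_zero, tsub_add_eq_max, add_tsub_eq_max]

lemma coe_sub_coe_eq_coe_add_coe {P I Hp Hm N : ℝ≥0∞} (hp : Hp ≠ ⊤) (hm : Hm ≠ ⊤) (hN : N ≠ ⊤)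
    (h : P + Hm = I + Hp + N) :
    (P : EReal) - (N : EReal) = (I : EReal) + ((Hp.toReal - Hm.toReal : ℝ) : EReal) := by
  lift Hp to ℝ≥0 using hp
  lift Hm to ℝ≥0 using hm
  lift N to ℝ≥0 using hN
  rcases eq_or_ne I ⊤ with rfl | hI
  · have hP : P = ⊤ := by
      rw [top_add, top_add] at h
      exact (ENNReal.add_eq_top.1 h).resolve_right ENNReal.coe_ne_top
    subst hP
    rw [EReal.coe_ennreal_top, EReal.top_add_coe]
    exact EReal.top_sub_coe (N : ℝ)
  lift I to ℝ≥0 using hI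
  have hP : P ≠ ⊤ := by
    rintro rfl
    rw [top_add] at h
    exact absurd h.symm (by finiteness)
  lift P to ℝ≥0 using hP
  norm_cast at h
  rw [← NNReal.coe_inj] at h
  push_cast at h
  have : ((P : ℝ) - N : ℝ) = (I : ℝ) + (Hp - Hm) := by linarith
  have h2 := congrArg (fun r : ℝ => (r : EReal)) this
  simp only [EReal.coe_add, EReal.coe_sub] at h2
  simp only [ENNReal.coe_toReal, EReal.coe_sub]
  exact h2

end Transport

/-! ### Minimizers for a continuous perturbation of a nonnegative kernel. -/

section CompactEnergy

variable {C : Type*} [MetricSpace C] [CompactSpace C] [MeasurableSpace C] [BorelSpace C]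

lemma integrable_of_continuous {F : Type*} [NormedAddCommGroup F] {Y : Type*}
    [TopologicalSpace Y] [CompactSpace Y] [MeasurableSpace Y] [OpensMeasurableSpace Y]
    {f : Y → F} (hf : Continuous f) (μ : Measure Y) [IsFiniteMeasure μ] : Integrable f μ :=
  hf.integrable_of_hasCompactSupport (HasCompactSupport.of_compactSpace f)

/-- The energy of a sum of a nonnegative kernel and a bounded kernel. -/
lemma kernelEnergy_coe_add_coe {κ : C × C → ℝ≥0∞} (hκ : Continuous κ) {h : C × C → ℝ}
    (hh : Continuous h) (μ : ProbabilityMeasure C) :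
    kernelEnergy (fun a b => (κ (a, b) : EReal) + (h (a, b) : EReal)) (μ : Measure C)
      = (energy κ μ : EReal) + (realEnergy h μ : EReal) := by
  have hκm := hκ.measurable
  have hhm := hh.measurable
  have hint := integrable_of_continuous hh ((μ : Measure C).prod (μ : Measure C))
  have hp : ∫⁻ z, ENNReal.ofReal (h z) ∂((μ : Measure C).prod (μ : Measure C)) ≠ ⊤ :=
    hint.lintegral_lt_top.ne
  have hm : ∫⁻ z, ENNReal.ofReal (-h z) ∂((μ : Measure C).prod (μ : Measure C)) ≠ ⊤ :=
    hint.neg.lintegral_lt_top.ne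
  unfold kernelEnergy
  simp_rw [toENNReal_coe_add_coe, toENNReal_neg_coe_add_coe]
  rw [← lintegral_prod (fun z => κ z + ENNReal.ofReal (h z) - ENNReal.ofReal (-h z))
      (by fun_prop),
    ← lintegral_prod (fun z => ENNReal.ofReal (-h z) - κ z) (by fun_prop), realEnergy,
    integral_eq_lintegral_pos_part_sub_lintegral_neg_part hint]
  refine coe_sub_coe_eq_coe_add_coe hp hm
    ((lintegral_mono fun z => tsub_le_self).trans_lt hm.lt_top).ne ?_
  rw [energy, ← lintegral_add_right _ (by fun_prop), ← lintegral_add_right _ (by fun_prop),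
    ← lintegral_add_right _ (by fun_prop)]
  exact lintegral_congr fun z => add_ofReal_decomp _ _

/-- The energy with a bounded continuous perturbation has a minimizer. -/
lemma exists_forall_energy_add_realEnergy_le [Nonempty C] {κ : C × C → ℝ≥0∞}
    (hκ : Continuous κ) {h : C × C → ℝ} (hh : Continuous h) :
    ∃ μ, ∀ ν, (energy κ μ : EReal) + (realEnergy h μ : EReal)
      ≤ (energy κ ν : EReal) + (realEnergy h ν : EReal) := by
  -- Subtracting a lower bound of `h` makes the whole kernel nonnegative and changes every energy by
  -- the same constant.
  obtain ⟨c, hc⟩ := (isCompact_range hh).bddBelow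
  have hc' : ∀ z, 0 ≤ h z - c := fun z => sub_nonneg.2 (hc ⟨z, rfl⟩)
  have hκc : Continuous fun z => κ z + ENNReal.ofReal (h z - c) :=
    hκ.add (ENNReal.continuous_ofReal.comp (hh.sub continuous_const))
  obtain ⟨μ, hμ⟩ := exists_forall_energy_le hκc
  have key : ∀ ν : ProbabilityMeasure C, energy (fun z => κ z + ENNReal.ofReal (h z - c)) ν
      = energy κ ν + ENNReal.ofReal (realEnergy h ν - c) := by
    intro ν
    have hi := integrable_of_continuous hh ((ν : Measure C).prod (ν : Measure C))
    have : realEnergy h ν - c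
        = ∫ z, (h z - c) ∂((ν : Measure C).prod (ν : Measure C)) := by
      rw [integral_sub hi (integrable_const _), integral_const, probReal_univ, one_smul,
        realEnergy]
    have hi' : Integrable (fun z => h z - c) ((ν : Measure C).prod (ν : Measure C)) :=
      hi.sub (integrable_const _)
    rw [this, ofReal_integral_eq_lintegral_ofReal hi' (Eventually.of_forall hc'), energy, energy,
      lintegral_add_left hκ.measurable]
  have hnn : ∀ ν : ProbabilityMeasure C, 0 ≤ realEnergy h ν - c := by
    intro ν
    rw [sub_nonneg]
    have hi := integrable_of_continuous hh ((ν : Measure C).prod (ν : Measure C))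
    have := integral_mono (integrable_const c) hi fun z => hc ⟨z, rfl⟩
    simpa [realEnergy] using this
  refine ⟨μ, fun ν => ?_⟩
  have h1 := hμ ν
  rw [key, key, ← EReal.coe_ennreal_le_coe_ennreal_iff, EReal.coe_ennreal_add,
    EReal.coe_ennreal_add, EReal.coe_ennreal_ofReal, EReal.coe_ennreal_ofReal,
    max_eq_left (hnn μ), max_eq_left (hnn ν)] at h1
  have h2 := add_le_add_left h1 (c : EReal)
  rwa [add_assoc, add_assoc, ← EReal.coe_add, ← EReal.coe_add, sub_add_cancel,
    sub_add_cancel] at h2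

variable {X : Type*} [MeasurableSpace X]

/-- On a compact set, a kernel that is a continuous kernel with values in `[0,∞]` plus a continuous
real kernel has an equilibrium measure. -/
lemma exists_isEquilibriumMeasure_map [Nonempty C] {f : C → X} (hf : MeasurableEmbedding f)
    {G : X → X → EReal} {κ : C × C → ℝ≥0∞} (hκ : Continuous κ) {h : C × C → ℝ}
    (hh : Continuous h) (hG : ∀ a b, G (f a) (f b) = (κ (a, b) : EReal) + (h (a, b) : EReal)) :
    ∃ μ : ProbabilityMeasure C,
      IsEquilibriumMeasure G (Set.range f) ((μ : Measure C).map f) ∧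
      minEnergy G (Set.range f) = (energy κ μ : EReal) + (realEnergy h μ : EReal) ∧
      ∀ ν : ProbabilityMeasure C, (energy κ μ : EReal) + (realEnergy h μ : EReal)
        ≤ (energy κ ν : EReal) + (realEnergy h ν : EReal) := by
  obtain ⟨μ, hμ⟩ := exists_forall_energy_add_realEnergy_le hκ hh
  have hE : ∀ ν : ProbabilityMeasure C, kernelEnergy G ((ν : Measure C).map f)
      = (energy κ ν : EReal) + (realEnergy h ν : EReal) := by
    intro ν
    rw [kernelEnergy_map hf]
    simp_rw [hG]
    exact kernelEnergy_coe_add_coe hκ hh ν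
  have hP : IsProbOn (Set.range f) ((μ : Measure C).map f) :=
    (isProbOn_range_iff hf _).2 ⟨μ, rfl⟩
  have hmin : minEnergy G (Set.range f)
      = (energy κ μ : EReal) + (realEnergy h μ : EReal) := by
    refine le_antisymm ?_ (le_iInf₂ fun ν hν => ?_)
    · rw [← hE]
      exact iInf₂_le _ hP
    · obtain ⟨ν', rfl⟩ := (isProbOn_range_iff hf _).1 hν
      rw [hE]
      exact hμ ν'
  exact ⟨μ, ⟨hP, by rw [hE, hmin]⟩, hmin, hμ⟩

/-- The second moment is half the mean squared distance of two independent points. -/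
lemma integral_norm_sub_sq {F : Type*} [NormedAddCommGroup F] [InnerProductSpace ℝ F]
    [CompleteSpace F] {v : C → F} (hv : Continuous v) (μ : Measure C) [IsProbabilityMeasure μ] :
    ∫ z : C × C, ‖v z.1 - v z.2‖ ^ 2 ∂(μ.prod μ)
      = 2 * ∫ a, ‖v a - ∫ b, v b ∂μ‖ ^ 2 ∂μ := by
  set c := ∫ b, v b ∂μ with hc
  have hvi := integrable_of_continuous hv μ
  have hw : Continuous fun a => v a - c := hv.sub continuous_const
  have hwi := integrable_of_continuous hw μ
  have h0 : ∫ a, (v a - c) ∂μ = 0 := by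
    rw [integral_sub hvi (integrable_const _)]; simp [hc]
  have hsq : Integrable (fun a => ‖v a - c‖ ^ 2) μ :=
    integrable_of_continuous (hw.norm.pow 2) μ
  have hci : Continuous fun z : C × C => ‖v z.1 - v z.2‖ ^ 2 :=
    (((hv.comp continuous_fst).sub (hv.comp continuous_snd)).norm).pow 2
  rw [integral_prod _ (integrable_of_continuous hci _)]
  -- After centring at the mean, the cross term integrates to zero.
  have hexp : ∀ a b, ‖v a - v b‖ ^ 2
      = ‖v a - c‖ ^ 2 + ‖v b - c‖ ^ 2 - 2 * inner ℝ (v a - c) (v b - c) := by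
    intro a b
    rw [show v a - v b = (v a - c) - (v b - c) by abel, norm_sub_sq_real]
    ring
  have hin : ∀ a, ∫ b, ‖v a - v b‖ ^ 2 ∂μ
      = ‖v a - c‖ ^ 2 + ∫ b, ‖v b - c‖ ^ 2 ∂μ := by
    intro a
    simp_rw [hexp]
    have hadd : Integrable (fun b => ‖v a - c‖ ^ 2 + ‖v b - c‖ ^ 2) μ :=
      (integrable_const _).add hsq
    rw [integral_sub hadd ((hwi.const_inner (v a - c)).const_mul 2),
      integral_add (integrable_const _) hsq, integral_const_mul, integral_inner hwi, h0,
      inner_zero_right, integral_const, probReal_univ, one_smul]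
    ring
  simp_rw [hin]
  rw [integral_add hsq (integrable_const _), integral_const, probReal_univ, one_smul]
  ring

end CompactEnergy

/-! ### Existence and uniqueness of the Riesz equilibrium measure. -/

section Riesz

lemma kernelEnergy_rieszKernel {X : Type*} [PseudoEMetricSpace X] [MeasurableSpace X] (q : ℝ)
    (μ : Measure X) :
    kernelEnergy (rieszKernel q) μ = ((∫⁻ x, ∫⁻ y, edist x y ^ (-q) ∂μ ∂μ : ℝ≥0∞) : EReal) := by
  have h : ∀ x y : X, (-rieszKernel q x y).toENNReal = 0 := fun x y =>
    EReal.toENNReal_of_nonpos (EReal.neg_le_zero.2 (EReal.coe_ennreal_nonneg _))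
  unfold kernelEnergy
  simp_rw [h]
  simp [rieszKernel]

lemma isProbOn_midpoint {X : Type*} [MeasurableSpace X] {K : Set X} {μ ν : Measure X}
    (hμ : IsProbOn K μ) (hν : IsProbOn K ν) : IsProbOn K ((2⁻¹ : ℝ≥0∞) • (μ + ν)) := by
  have := hμ.1
  have := hν.1
  refine ⟨⟨?_⟩, ?_⟩
  · rw [Measure.smul_apply, Measure.add_apply, measure_univ, measure_univ, smul_eq_mul,
      one_add_one_eq_two, ENNReal.inv_mul_cancel (by simp) (by simp)]
  · rw [Measure.smul_apply, Measure.add_apply, hμ.2, hν.2]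
    simp

/-- Riesz equilibrium measures are unique when the Riesz energy is finite. -/
lemma IsEquilibriumMeasure.eq_of_rieszKernel {E : Type*} [NormedAddCommGroup E]
    [InnerProductSpace ℝ E] [FiniteDimensional ℝ E] [MeasurableSpace E] [BorelSpace E]
    {q : ℝ} (hq : 0 < q) {K : Set E} (hfin : rieszEnergy q K < ⊤) {μ ν : Measure E}
    (hμ : IsEquilibriumMeasure (rieszKernel q) K μ)
    (hν : IsEquilibriumMeasure (rieszKernel q) K ν) : μ = ν := by
  have := hμ.1.1
  have := hν.1.1
  have h1 := hμ.2
  have h2 := hν.2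
  -- The midpoint of two minimizers is itself a competitor, so its energy cannot be smaller.
  have hm : minEnergy (rieszKernel q) K
      ≤ kernelEnergy (rieszKernel q) ((2⁻¹ : ℝ≥0∞) • (μ + ν)) :=
    iInf₂_le _ (isProbOn_midpoint hμ.1 hν.1)
  have hV : (∫⁻ x, ∫⁻ y, edist x y ^ (-q) ∂μ ∂μ : ℝ≥0∞) ≠ ⊤ := by
    intro htop
    rw [rieszEnergy, ← h1, kernelEnergy_rieszKernel, htop] at hfin
    exact absurd hfin (by simp)
  refine eq_of_riesz_midpoint hq hV le_rfl ?_ ?_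
  · rw [← EReal.coe_ennreal_le_coe_ennreal_iff, ← kernelEnergy_rieszKernel,
      ← kernelEnergy_rieszKernel, h1, h2]
  · rw [← EReal.coe_ennreal_le_coe_ennreal_iff, ← kernelEnergy_rieszKernel,
      ← kernelEnergy_rieszKernel, h1]
    exact hm

lemma nonempty_of_minEnergy_lt_top {X : Type*} [MeasurableSpace X] {G : X → X → EReal}
    {K : Set X} (h : minEnergy G K < ⊤) : K.Nonempty := by
  by_contra hK
  rw [Set.not_nonempty_iff_eq_empty] at hK
  subst hK
  refine h.ne (iInf₂_eq_top.2 fun μ hμ => ?_)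
  have := hμ.1
  have h2 := hμ.2
  simp at h2

/-- The Riesz kernel on a set, as a function on pairs. -/
noncomputable def rieszPair {X : Type*} [PseudoEMetricSpace X] (q : ℝ) (K : Set X)
    (z : K × K) : ℝ≥0∞ := edist z.1 z.2 ^ (-q)

lemma continuous_rieszPair {X : Type*} [PseudoEMetricSpace X] (q : ℝ) (K : Set X) :
    Continuous (rieszPair q K) :=
  ENNReal.continuous_rpow_const.comp (continuous_fst.edist continuous_snd)

/-- Existence and uniqueness of the Riesz equilibrium measure, in terms of probability measures
on the compact subtype. -/
lemma exists_riesz_equilibrium {E : Type*} [NormedAddCommGroup E]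
    [InnerProductSpace ℝ E] [FiniteDimensional ℝ E] [MeasurableSpace E] [BorelSpace E]
    {q : ℝ} (hq : 0 < q) {K : Set E} (hK : IsCompact K) (hfin : rieszEnergy q K < ⊤) :
    ∃ μ₀ : ProbabilityMeasure K,
      IsEquilibriumMeasure (rieszKernel q) K ((μ₀ : Measure K).map Subtype.val) ∧
      rieszEnergy q K = (energy (rieszPair q K) μ₀ : EReal) ∧ energy (rieszPair q K) μ₀ ≠ ⊤ ∧
      ∀ ν, energy (rieszPair q K) ν ≤ energy (rieszPair q K) μ₀ → ν = μ₀ := by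
  have : CompactSpace K := isCompact_iff_compactSpace.1 hK
  have : Nonempty K := (nonempty_of_minEnergy_lt_top hfin).to_subtype
  have hf : MeasurableEmbedding (Subtype.val : K → E) :=
    MeasurableEmbedding.subtype_coe hK.measurableSet
  have hκ := continuous_rieszPair q K
  -- The general existence result is used with zero perturbation.
  have h0 : Continuous fun _ : K × K => (0 : ℝ) := continuous_const
  have hz : ∀ ν : ProbabilityMeasure K, realEnergy (fun _ : K × K => (0 : ℝ)) ν = 0 :=
    fun ν => by simp [realEnergy]
  have hG : ∀ a b : K, rieszKernel q (a : E) b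
      = (rieszPair q K (a, b) : EReal) + ((0 : ℝ) : EReal) := by
    intro a b
    rw [EReal.coe_zero, add_zero]
    rfl
  obtain ⟨μ₀, h1, h2, h3⟩ := exists_isEquilibriumMeasure_map hf hκ h0 hG
  simp only [hz, EReal.coe_zero, add_zero, Subtype.range_coe] at h1 h2 h3
  refine ⟨μ₀, h1, h2, ?_, fun ν hν => ?_⟩
  · intro htop
    rw [rieszEnergy, h2, htop] at hfin
    exact absurd hfin (by simp)
  · have hE : kernelEnergy (rieszKernel q) ((ν : Measure K).map Subtype.val)
        = (energy (rieszPair q K) ν : EReal) := by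
      rw [kernelEnergy_map hf]
      simp_rw [hG]
      rw [kernelEnergy_coe_add_coe hκ h0, hz, EReal.coe_zero, add_zero]
    have hP : IsProbOn K ((ν : Measure K).map Subtype.val) := by
      have := (isProbOn_range_iff hf _).2 ⟨ν, rfl⟩
      rwa [Subtype.range_coe] at this
    have hν' : IsEquilibriumMeasure (rieszKernel q) K ((ν : Measure K).map Subtype.val) := by
      refine ⟨hP, ?_⟩
      rw [hE, h2]
      exact le_antisymm (EReal.coe_ennreal_le_coe_ennreal_iff.2 hν) (h3 ν)
    have heq := hν'.eq_of_rieszKernel hq hfin h1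
    refine Subtype.ext ?_
    have := congrArg (fun m => Measure.comap (Subtype.val : K → E) m) heq
    simp only [hf.comap_map] at this
    exact this

end Riesz

/-! ### Strip equilibrium measures and the energy of the reflection part. -/

section Strip

variable {n : ℕ} {K : Set (EuclideanSpace ℝ (Fin n))}

lemma isometry_point_zero : Isometry fun x : EuclideanSpace ℝ (Fin n) => point x 0 := by
  refine Isometry.of_dist_eq fun x y => ?_
  rw [WithLp.prod_dist_eq_of_L2]
  simp [point, Real.sqrt_sq]

/-- The reflection part as a kernel on `K`. -/
noncomputable def reflectionPair (q t : ℝ) (K : Set (EuclideanSpace ℝ (Fin n))) (z : K × K) : ℝ :=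
  reflectionPart q t (dist z.1 z.2 ^ 2)

lemma continuous_sq_dist : Continuous fun z : K × K => dist z.1 z.2 ^ 2 :=
  (continuous_fst.dist continuous_snd).pow 2

lemma continuous_reflectionPair {q t : ℝ} (hq : 0 < q) (ht : 0 < t) [CompactSpace K] :
    Continuous (reflectionPair q t K) := by
  obtain ⟨R, hR⟩ := (isCompact_range (continuous_sq_dist (K := K))).bddAbove
  exact (continuousOn_reflectionPart (R := R) hq ht).comp_continuous continuous_sq_dist
    fun z => ⟨sq_nonneg _, hR ⟨z, rfl⟩⟩

/-- The strip energy in terms of probability measures on the compact subtype. -/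
lemma exists_strip_equilibrium {q t : ℝ} (hq : 1 ≤ q) (ht : 0 < t) (hK : IsCompact K)
    {μ₀ : ProbabilityMeasure K} (hμ₀ : energy (rieszPair q K) μ₀ ≠ ⊤) :
    ∃ μ : ProbabilityMeasure K,
      IsEquilibriumMeasure (stripKernel q t) (embed K)
        ((μ : Measure K).map fun x : K => point (x : EuclideanSpace ℝ (Fin n)) 0) ∧
      stripEnergy q (embed K) t = (((energy (rieszPair q K) μ).toReal
        + (coeffA q t / (2 * t) ^ q + realEnergy (reflectionPair q t K) μ) : ℝ) : EReal) ∧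
      energy (rieszPair q K) μ ≠ ⊤ ∧
      ∀ ν : ProbabilityMeasure K, energy (rieszPair q K) ν ≠ ⊤ →
        (energy (rieszPair q K) μ).toReal + realEnergy (reflectionPair q t K) μ
          ≤ (energy (rieszPair q K) ν).toReal + realEnergy (reflectionPair q t K) ν := by
  have : CompactSpace K := isCompact_iff_compactSpace.1 hK
  have hq0 : 0 < q := by linarith
  have : Nonempty K := by
    by_contra hne
    rw [not_nonempty_iff] at hne
    have h1 : (μ₀ : Measure K) Set.univ = 1 := measure_univ
    rw [Set.univ_eq_empty_iff.2 hne, measure_empty] at h1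
    exact zero_ne_one h1
  have hi : Isometry fun x : K => point (x : EuclideanSpace ℝ (Fin n)) 0 :=
    isometry_point_zero.comp isometry_subtype_coe
  have hf : MeasurableEmbedding fun x : K => point (x : EuclideanSpace ℝ (Fin n)) 0 :=
    hi.isClosedEmbedding.measurableEmbedding
  have hrange : Set.range (fun x : K => point (x : EuclideanSpace ℝ (Fin n)) 0) = embed K := by
    rw [embed, Set.image_eq_range]
  have hg := continuous_reflectionPair (K := K) hq0 ht
  have hh : Continuous fun z => coeffA q t / (2 * t) ^ q + reflectionPair q t K z :=
    continuous_const.add hg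
  have hJ : ∀ ν : ProbabilityMeasure K,
      realEnergy (fun z => coeffA q t / (2 * t) ^ q + reflectionPair q t K z) ν
        = coeffA q t / (2 * t) ^ q + realEnergy (reflectionPair q t K) ν := by
    intro ν
    rw [realEnergy, integral_add (integrable_const _) (integrable_of_continuous hg _),
      integral_const, probReal_univ, one_smul, realEnergy]
  have hsum : ∀ ν : ProbabilityMeasure K, energy (rieszPair q K) ν ≠ ⊤ → ∀ r : ℝ,
      (energy (rieszPair q K) ν : EReal) + (r : EReal)
        = (((energy (rieszPair q K) ν).toReal + r : ℝ) : EReal) := by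
    intro ν hν r
    rw [EReal.coe_add]
    rw [← ENNReal.coe_toNNReal hν]
    rfl
  obtain ⟨μ, h1, h2, h3⟩ := exists_isEquilibriumMeasure_map hf (continuous_rieszPair q K) hh
    (fun a b => stripKernel_point hq ht (a : EuclideanSpace ℝ (Fin n)) b)
  rw [hrange] at h1 h2
  simp_rw [hJ] at h2 h3
  -- The competitor `μ₀` has finite strip energy, so the minimizer has finite Riesz energy.
  have hμ : energy (rieszPair q K) μ ≠ ⊤ := by
    intro htop
    have := h3 μ₀
    rw [htop, EReal.coe_ennreal_top, EReal.top_add_coe, hsum μ₀ hμ₀, top_le_iff] at this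
    exact EReal.coe_ne_top _ this
  refine ⟨μ, h1, ?_, hμ, fun ν hν => ?_⟩
  · rw [stripEnergy, h2, hsum μ hμ]
  · have := h3 ν
    rw [hsum μ hμ, hsum ν hν, EReal.coe_le_coe_iff] at this
    linarith

lemma coeffB_nonneg {q : ℝ} (hq : 0 < q) : 0 ≤ coeffB q :=
  mul_nonneg hq.le ((hasSum_riemannZeta_re (s := q + 2) (by linarith)).nonneg
    fun n => by positivity)

/-- The second-order expansion of the energy of the reflection part. -/
lemma exists_realEnergy_reflectionPair_bounds {q : ℝ} (hq : 0 < q) [CompactSpace K] :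
    ∃ c : ℝ, 0 ≤ c ∧ ∀ t : ℝ, 0 < t → ∀ μ : ProbabilityMeasure K,
      -(coeffB q * (2 * t) ^ (-(q + 2))) * realEnergy (fun z : K × K => dist z.1 z.2 ^ 2) μ
        ≤ realEnergy (reflectionPair q t K) μ ∧
      realEnergy (reflectionPair q t K) μ
        ≤ -(coeffB q * (2 * t) ^ (-(q + 2))) * realEnergy (fun z : K × K => dist z.1 z.2 ^ 2) μ
          + c * (2 * t) ^ (-(q + 4)) := by
  obtain ⟨R, hR⟩ := (isCompact_range (continuous_sq_dist (K := K))).bddAbove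
  have hZ : 0 ≤ (riemannZeta ((q + 4 : ℝ) : ℂ)).re :=
    (hasSum_riemannZeta_re (s := q + 4) (by linarith)).nonneg fun n => by positivity
  refine ⟨(q + q ^ 2 / 2) * (riemannZeta ((q + 4 : ℝ) : ℂ)).re * R ^ 2, by positivity,
    fun t ht μ => ?_⟩
  have hd := integrable_of_continuous (continuous_sq_dist (K := K))
    ((μ : Measure K).prod (μ : Measure K))
  have hg := integrable_of_continuous (continuous_reflectionPair (K := K) hq ht)
    ((μ : Measure K).prod (μ : Measure K))
  have hb := fun z : K × K => reflectionPart_bounds hq ht (sq_nonneg (dist z.1 z.2))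
  simp only [realEnergy]
  rw [← integral_const_mul]
  constructor
  · exact integral_mono (hd.const_mul _) hg fun z => (hb z).1
  · have hc := integral_const (μ := (μ : Measure K).prod (μ : Measure K))
      ((q + q ^ 2 / 2) * (riemannZeta ((q + 4 : ℝ) : ℂ)).re * R ^ 2 * (2 * t) ^ (-(q + 4)))
    rw [probReal_univ, one_smul] at hc
    rw [← hc, ← integral_add (hd.const_mul _) (integrable_const _)]
    refine integral_mono hg ((hd.const_mul _).add (integrable_const _)) fun z => ?_
    refine (hb z).2.trans (add_le_add_right ?_ _)
    have : dist z.1 z.2 ^ 2 ≤ R := hR ⟨z, rfl⟩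
    gcongr

end Strip

/-! ### The two-sided estimate of the strip energy. -/

section Asymptotics

variable {n : ℕ} {K : Set (EuclideanSpace ℝ (Fin n))}

lemma realEnergy_sq_dist [CompactSpace K] (hK : IsCompact K) (μ : ProbabilityMeasure K) :
    realEnergy (fun z : K × K => dist z.1 z.2 ^ 2) μ
      = 2 * secondMoment ((μ : Measure K).map Subtype.val) := by
  have hf : MeasurableEmbedding (Subtype.val : K → EuclideanSpace ℝ (Fin n)) :=
    MeasurableEmbedding.subtype_coe hK.measurableSet
  rw [secondMoment, centroid, hf.integral_map, hf.integral_map]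
  have := integral_norm_sub_sq (continuous_subtype_val (p := (· ∈ K))) (μ : Measure K)
  simp_rw [← dist_eq_norm] at this ⊢
  exact this

/-- The energy expansion for wide strips, for an equilibrium measure `μ₀` given on the compact
subtype. -/
lemma isLittleO_stripEnergy {q : ℝ} (hq : 1 ≤ q) (hK : IsCompact K) {μ₀ : ProbabilityMeasure K}
    (hV : rieszEnergy q K = (energy (rieszPair q K) μ₀ : EReal))
    (hVfin : energy (rieszPair q K) μ₀ ≠ ⊤)
    (huniq : ∀ ν, energy (rieszPair q K) ν ≤ energy (rieszPair q K) μ₀ → ν = μ₀) :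
    (fun t : ℝ => (stripEnergy q (embed K) t).toReal
        - ((rieszEnergy q K).toReal + coeffA q t / (2 * t) ^ q
          - 2 * coeffB q / (2 * t) ^ (q + 2)
            * secondMoment ((μ₀ : Measure K).map Subtype.val)))
      =o[atTop] (fun t : ℝ => 1 / t ^ (q + 2)) := by
  have hq0 : 0 < q := by linarith
  have hcs : CompactSpace K := isCompact_iff_compactSpace.1 hK
  obtain ⟨c, hc, hbounds⟩ := exists_realEnergy_reflectionPair_bounds (K := K) hq0
  obtain ⟨R, hR⟩ := (isCompact_range
    (continuous_realEnergy (continuous_sq_dist (K := K)))).bddAbove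
  set D : ProbabilityMeasure K → ℝ := realEnergy (fun z : K × K => dist z.1 z.2 ^ 2) with hD
  set b : ℝ → ℝ := fun t => coeffB q * (2 * t) ^ (-(q + 2)) with hb
  set e : ℝ → ℝ := fun t => c * (2 * t) ^ (-(q + 4)) with he
  have hDR : ∀ μ, D μ ≤ R := fun μ => hR ⟨μ, rfl⟩
  have hD0 : ∀ μ, 0 ≤ D μ := fun μ => integral_nonneg fun z => sq_nonneg _
  have hR0 : 0 ≤ R := (hD0 μ₀).trans (hDR μ₀)
  have hB := coeffB_nonneg hq0
  have htwo : Tendsto (fun t : ℝ => 2 * t) atTop atTop :=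
    tendsto_id.const_mul_atTop two_pos
  have hblim : Tendsto b atTop (𝓝 0) := by
    have := ((tendsto_rpow_neg_atTop (by linarith : 0 < q + 2)).comp htwo).const_mul (coeffB q)
    rwa [mul_zero] at this
  have helim : Tendsto e atTop (𝓝 0) := by
    have := ((tendsto_rpow_neg_atTop (by linarith : 0 < q + 4)).comp htwo).const_mul c
    rwa [mul_zero] at this
  have hVr : (rieszEnergy q K).toReal = (energy (rieszPair q K) μ₀).toReal := by
    rw [hV]
    exact EReal.toReal_coe_ennreal
  -- The term `b t * ε` comes from the lower bound, through stability; `e t` comes from testing with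
  -- `μ₀`.
  have hsq : ∀ ε : ℝ, 0 < ε → ∀ᶠ t : ℝ in atTop,
      ‖(stripEnergy q (embed K) t).toReal - ((rieszEnergy q K).toReal + coeffA q t / (2 * t) ^ q
        - 2 * coeffB q / (2 * t) ^ (q + 2)
          * secondMoment ((μ₀ : Measure K).map Subtype.val))‖ ≤ b t * ε + e t := by
    intro ε hε
    obtain ⟨δ, hδ, hstab⟩ := exists_pos_forall_le_add (continuous_rieszPair q K)
      (continuous_realEnergy (continuous_sq_dist (K := K))) huniq hε
    have hsmall : ∀ᶠ t in atTop, b t * R + e t < δ := by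
      have : Tendsto (fun t => b t * R + e t) atTop (𝓝 0) := by
        simpa using (hblim.mul_const R).add helim
      exact this.eventually_lt_const hδ
    filter_upwards [hsmall, eventually_gt_atTop 0] with t hts ht
    obtain ⟨μ, -, hE, hμfin, hmin⟩ := exists_strip_equilibrium hq ht hK hVfin
    have hbt : 0 ≤ b t := by simp only [hb]; positivity
    have het : 0 ≤ e t := by simp only [he]; positivity
    have h1 := hmin μ₀ hVfin
    obtain ⟨hl, -⟩ := hbounds t ht μ
    obtain ⟨-, hu⟩ := hbounds t ht μ₀
    have hVμ : (energy (rieszPair q K) μ₀).toReal ≤ (energy (rieszPair q K) μ).toReal := by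
      by_contra hlt
      have hle : energy (rieszPair q K) μ ≤ energy (rieszPair q K) μ₀ :=
        (ENNReal.toReal_le_toReal hμfin hVfin).1 (not_le.1 hlt).le
      exact hlt (huniq μ hle ▸ le_rfl)
    have hbD : b t * D μ ≤ b t * R := mul_le_mul_of_nonneg_left (hDR μ) hbt
    have hbD0 : 0 ≤ b t * D μ₀ := mul_nonneg hbt (hD0 μ₀)
    -- Comparison with `μ₀` bounds the excess Riesz energy by `b t * D μ + e t`, hence by `b t * R +
    -- e t < δ`.
    have hnear : energy (rieszPair q K) μ ≤ energy (rieszPair q K) μ₀ + ENNReal.ofReal δ := by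
      rw [← ENNReal.toReal_le_toReal hμfin (by finiteness), ENNReal.toReal_add hVfin (by simp),
        ENNReal.toReal_ofReal hδ.le]
      linarith
    have hDμ := mul_le_mul_of_nonneg_left (hstab μ hnear) hbt
    have hM : 2 * coeffB q / (2 * t) ^ (q + 2) * secondMoment ((μ₀ : Measure K).map Subtype.val)
        = b t * D μ₀ := by
      simp only [hb, hD]
      rw [realEnergy_sq_dist hK, Real.rpow_neg (by positivity)]
      ring
    rw [hE, EReal.toReal_coe, hVr, hM, Real.norm_eq_abs, abs_le]
    have hbe : 0 ≤ b t * ε := mul_nonneg hbt hε.le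
    constructor
    · linarith
    · linarith
  refine isLittleO_iff.2 fun r hr => ?_
  -- This `ε` gives `b t * ε ≤ (r/2) t^{-(q+2)}`; the `+ 1` keeps the denominator positive, as
  -- `coeffB` is only known to be nonnegative.
  have hε : 0 < r / 2 / (coeffB q * 2 ^ (-(q + 2)) + 1) := by positivity
  have hinv : ∀ᶠ t : ℝ in atTop, c * 2 ^ (-(q + 4)) * t ^ (-2 : ℝ) < r / 2 := by
    have : Tendsto (fun t : ℝ => c * 2 ^ (-(q + 4)) * t ^ (-2 : ℝ)) atTop (𝓝 0) := by
      simpa using (tendsto_rpow_neg_atTop (two_pos : (0 : ℝ) < 2)).const_mul (c * 2 ^ (-(q + 4)))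
    exact this.eventually_lt_const (half_pos hr)
  filter_upwards [hsq _ hε, hinv, eventually_gt_atTop 0] with t h1 h2 ht
  refine h1.trans ?_
  have hτ : 0 < t ^ (-(q + 2)) := by positivity
  have hn : ‖1 / t ^ (q + 2)‖ = t ^ (-(q + 2)) := by
    rw [Real.norm_of_nonneg (by positivity), Real.rpow_neg ht.le, one_div]
  have hbt : b t = coeffB q * 2 ^ (-(q + 2)) * t ^ (-(q + 2)) := by
    simp only [hb]
    rw [Real.mul_rpow two_pos.le ht.le]; ring
  have het : e t = c * 2 ^ (-(q + 4)) * t ^ (-2 : ℝ) * t ^ (-(q + 2)) := by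
    simp only [he]
    rw [Real.mul_rpow two_pos.le ht.le, mul_assoc (c * _), ← Real.rpow_add ht,
      show (-2 : ℝ) + -(q + 2) = -(q + 4) by ring]
    ring
  have hfrac : coeffB q * 2 ^ (-(q + 2)) * (r / 2 / (coeffB q * 2 ^ (-(q + 2)) + 1)) ≤ r / 2 := by
    have hpos : 0 < coeffB q * 2 ^ (-(q + 2)) + 1 := by positivity
    rw [mul_div_assoc', div_le_iff₀ hpos]
    nlinarith
  rw [hn, hbt, het]
  have := mul_le_mul_of_nonneg_right (add_le_add hfrac h2.le) hτ.le
  linarith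

end Asymptotics

end StripEnergy

theorem corollary3p2 (n : ℕ) (q : ℝ) (hq : 1 ≤ q) (hqn : q < n)
    (K : Set (EuclideanSpace ℝ (Fin n))) (hK : IsCompact K)
    (hfin : StripEnergy.rieszEnergy q K < ⊤) :
    (∃! μ : Measure (EuclideanSpace ℝ (Fin n)),
      StripEnergy.IsEquilibriumMeasure (StripEnergy.rieszKernel q) K μ) ∧
    (∀ t : ℝ, 0 < t → StripEnergy.stripEnergy q (StripEnergy.embed K) t ≠ ⊥ ∧
      StripEnergy.stripEnergy q (StripEnergy.embed K) t ≠ ⊤ ∧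
      ∃ ν : Measure (StripEnergy.Space n),
        StripEnergy.IsEquilibriumMeasure (StripEnergy.stripKernel q t) (StripEnergy.embed K) ν) ∧
    ∀ μ : Measure (EuclideanSpace ℝ (Fin n)),
      StripEnergy.IsEquilibriumMeasure (StripEnergy.rieszKernel q) K μ →
      (fun t : ℝ =>
        (StripEnergy.stripEnergy q (StripEnergy.embed K) t).toReal
          - ((StripEnergy.rieszEnergy q K).toReal
            + StripEnergy.coeffA q t / (2 * t) ^ q
            - 2 * StripEnergy.coeffB q / (2 * t) ^ (q + 2) * StripEnergy.secondMoment μ))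
        =o[atTop] (fun t : ℝ => 1 / t ^ (q + 2)) := by
  have hq0 : 0 < q := by linarith
  obtain ⟨μ₀, hμ₀, hV, hVfin, huniq⟩ := StripEnergy.exists_riesz_equilibrium hq0 hK hfin
  refine ⟨⟨_, hμ₀, fun ν hν => hν.eq_of_rieszKernel hq0 hfin hμ₀⟩, fun t ht => ?_, fun μ hμ => ?_⟩
  · obtain ⟨μ, h1, h2, -, -⟩ := StripEnergy.exists_strip_equilibrium hq ht hK hVfin
    rw [h2]
    exact ⟨EReal.coe_ne_bot _, EReal.coe_ne_top _, _, h1⟩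
  · obtain rfl := hμ.eq_of_rieszKernel hq0 hfin hμ₀
    exact StripEnergy.isLittleO_stripEnergy hq hK hV hVfin huniq
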